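/- Let $N\ge 3$, $\mathbb{R}_+=(0,\infty)$, and let $V:\mathbb{R}_+\to[0,\infty)$, $K:\mathbb{R}_+\to(0,\infty)$ be continuous, with a constant $C>0$ such that $V(r)\le C/r^2$ for all $r\in(0,1)$. Let $f:\mathbb{R}\to\mathbb{R}$ be the unique solution of $f'(t)=\dfrac{1}{\sqrt{1+2f(t)^2}}$ on $\mathbb{R}$, $f(0)=0$. Let $D^{1,2}_r(\mathbb{R}^N)$ be the closure of the radial functions of $C_c^\infty(\mathbb{R}^N)$ in the norm $\|u\|_{1,2}=\left(\int_{\mathbb{R}^N}|\nabla u|^2dx\right)^{1/2}$ (a space of functions in $L^{2N/(N-2)}(\mathbb{R}^N)$ with weak gradient in $L^2$), and let $$E=\Big\{u\in D^{1,2}_r(\mathbb{R}^N):\int_{\mathbb{R}^N}V(|x|)f(u)^2dx<\infty\Big\},\qquad \|u\|=\|u\|_{1,2}+\inf_{k>0}\frac1k\Big[1+\int_{\mathbb{R}^N}V(|x|)f(ku)^2dx\Big].$$ Let $q_1,q_2>1$ and assume that for some $R_1,R_2>0$ $$\sup_{u\in E,\ \|u\|=1}\int_{\{|x|<R_1\}}K(|x|)|u|^{q_1}dx<\infty,\qquad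 \sup_{u\in E,\ \|u\|=1}\int_{\{|x|\ge R_2\}}K(|x|)|u|^{q_2}dx<\infty.$$ Let $g:\mathbb{R}\to\mathbb{R}$ be continuous and put $G(t)=\int_0^tg(s)\,ds$. Assume that * there is $\theta>2$ with $0\le 2\theta G(t)\le g(t)t$ for all $t\in\mathbb{R}$; * there is $t_0>0$ with $G(t_0)>0$; * there is $C>0$ with $|g(t)|\le C\min\{|t|^{q_1-1},|t|^{q_2-1}\}$ for all $t\in\mathbb{R}$. Consider the functional $I:E\to\mathbb{R}$, $$I(u)=\frac12\int_{\mathbb{R}^N}|\nabla u|^2dx+\frac12\int_{\mathbb{R}^N}V(|x|)f(u)^2dx-\int_{\mathbb{R}^N}K(|x|)G(f(u))\,dx .$$ Then every critical point $u\in E$ of $I$ (that is, every $u\in E$ at which the Fréchet derivative of $I$ with respect to $\|\cdot\|$ exists and is $0$) belongs, after modification on a null set, to $C^2(\mathbb{R}^N\setminus\{0\})$, and it satisfies at every point of $\mathbb{R}^N\setminus\{0\}$ $$-\Delta u+V(|x|)f(u)f'(u)=K(|x|)g(f(u))f'(u).$$ -/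

import Mathlib

open MeasureTheory Filter Topology
open scoped ENNReal ContDiff Laplacian

namespace QSchrodinger

noncomputable section

/-! ### The change of variable -/

/-- `f` solves the Cauchy problem `f' = 1 / √(1 + 2 f²)` on `ℝ`, `f 0 = 0`. -/
def SolvesCauchy (f : ℝ → ℝ) : Prop :=
  f 0 = 0 ∧ ∀ t, HasDerivAt f (1 / Real.sqrt (1 + 2 * f t ^ 2)) t

theorem existsUnique_solvesCauchy : ∃! f : ℝ → ℝ, SolvesCauchy f := by
  have hpos : ∀ s : ℝ, 0 < Real.sqrt (1 + 2 * s ^ 2) := fun s =>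
    Real.sqrt_pos.2 (by positivity)
  have hone : ∀ s : ℝ, 1 ≤ Real.sqrt (1 + 2 * s ^ 2) := fun s => by
    rw [Real.one_le_sqrt]; nlinarith [sq_nonneg s]
  have hcont : Continuous fun s : ℝ => Real.sqrt (1 + 2 * s ^ 2) := by fun_prop
  obtain ⟨F, hF⟩ : ∃ F : ℝ → ℝ, F = fun s => ∫ τ in (0 : ℝ)..s, Real.sqrt (1 + 2 * τ ^ 2) :=
    ⟨_, rfl⟩
  have hFd : ∀ s, HasDerivAt F (Real.sqrt (1 + 2 * s ^ 2)) s := fun s => by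
    rw [hF]; exact hcont.integral_hasStrictDerivAt 0 s |>.hasDerivAt
  have hF0 : F 0 = 0 := by simp [hF]
  have hFm : StrictMono F := strictMono_of_hasDerivAt_pos hFd hpos
  have hmono : Monotone fun s => F s - s := by
    have hd : ∀ s, HasDerivAt (fun s => F s - s) (Real.sqrt (1 + 2 * s ^ 2) - 1) s := fun s =>
      (hFd s).sub (hasDerivAt_id s)
    refine monotone_of_deriv_nonneg (fun s => (hd s).differentiableAt) fun s => ?_
    rw [(hd s).deriv]; linarith [hone s]
  have hFc : Continuous F := continuous_iff_continuousAt.2 fun s => (hFd s).continuousAt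
  have hFs : Function.Surjective F := by
    refine hFc.surjective ?_ ?_
    · refine tendsto_atTop_mono' atTop ?_ tendsto_id
      filter_upwards [eventually_ge_atTop (0 : ℝ)] with s hs
      have h1 := hmono hs
      simp only [hF0] at h1
      simp only [id]; linarith
    · refine tendsto_atBot_mono' atBot ?_ tendsto_id
      filter_upwards [eventually_le_atBot (0 : ℝ)] with s hs
      have h1 := hmono hs
      simp only [hF0] at h1
      simp only [id]; linarith
  let e := hFm.orderIsoOfSurjective F hFs
  have he : ∀ s, e s = F s := fun s => rfl
  refine ⟨fun t => e.symm t, ⟨?_, fun t => ?_⟩, fun h hh => ?_⟩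
  · exact (e.symm_apply_eq).2 (by rw [he, hF0])
  · have h1 := (hFd (e.symm t)).of_local_left_inverse (f := F) (g := fun t => e.symm t)
      e.symm.continuous.continuousAt (hpos _).ne'
      (Eventually.of_forall fun y => by rw [← he]; exact e.apply_symm_apply y)
    simpa [one_div] using h1
  · funext t
    have hd : ∀ t, HasDerivAt (fun t => F (h t) - t) 0 t := fun t => by
      have h1 := ((hFd (h t)).comp t (hh.2 t)).sub (hasDerivAt_id t)
      have h2 : Real.sqrt (1 + 2 * h t ^ 2) * (1 / Real.sqrt (1 + 2 * h t ^ 2)) - 1 = 0 := by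
        rw [mul_one_div_cancel (hpos _).ne', sub_self]
      rw [h2] at h1
      exact h1
    have hc := is_const_of_deriv_eq_zero (fun t => (hd t).differentiableAt)
      (fun t => (hd t).deriv) t 0
    simp only [hh.1, hF0, sub_zero] at hc
    exact ((e.symm_apply_eq).2 (by rw [he]; linarith)).symm

/-- The function `f` of the change of variable `w = f(u)`. -/
def cv : ℝ → ℝ := existsUnique_solvesCauchy.choose

/-- `cv` is the solution of the Cauchy problem. -/
theorem cv_spec : SolvesCauchy cv := existsUnique_solvesCauchy.choose_spec.1

/-! ### Function spaces

Elements of the function spaces are represented by functions `ℝᴺ → ℝ`; every notion below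
depends only on the almost-everywhere class of the function. The potentials are functions of
`r > 0`; they are coded as functions `ℝ → ℝ` whose values at `r ≤ 0` are irrelevant. -/

/-- `ℝᴺ` with its Euclidean norm. -/
abbrev Euc (N : ℕ) : Type := EuclideanSpace ℝ (Fin N)

variable {N : ℕ}

/-- `G` is the weak gradient of `u` on `ℝᴺ`. -/
def HasWeakGradient (u : Euc N → ℝ) (G : Euc N → Euc N) : Prop :=
  LocallyIntegrable u volume ∧ LocallyIntegrable G volume ∧
    ∀ φ : Euc N → ℝ, ContDiff ℝ ∞ φ → HasCompactSupport φ →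
      ∫ x, u x • gradient φ x = - ∫ x, φ x • G x

open Classical in
/-- The weak gradient of `u` (unique up to null sets), and `0` if there is none. -/
def weakGradient (u : Euc N → ℝ) : Euc N → Euc N :=
  if h : ∃ G, HasWeakGradient u G then h.choose else 0

/-- The norm `‖u‖_{1,2} = (∫ |∇u|²)^{1/2}`. -/
def dirichletNorm (u : Euc N → ℝ) : ℝ :=
  Real.sqrt (∫ x, ‖weakGradient u x‖ ^ 2)

/-- The space `C_{c,r}^∞(ℝᴺ)` of radial smooth functions with compact support. -/
def IsRadialTest (φ : Euc N → ℝ) : Prop :=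
  ContDiff ℝ ∞ φ ∧ HasCompactSupport φ ∧ ∀ x y, ‖x‖ = ‖y‖ → φ x = φ y

/-- The critical Sobolev exponent `2* = 2N / (N - 2)`. -/
def critExp (N : ℕ) : ℝ≥0∞ := ENNReal.ofReal (2 * N / ((N : ℝ) - 2))

/-- The space `D_r^{1,2}(ℝᴺ)`: the closure of `C_{c,r}^∞(ℝᴺ)` in the norm `‖∇·‖_{L²}`.
By Sobolev's inequality a Cauchy sequence for this norm also converges in `L^{2*}`, and the
completion is realised as a space of functions in `L^{2*}` with weak gradient in `L²`. -/
def MemD (u : Euc N → ℝ) : Prop :=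
  MemLp u (critExp N) volume ∧
  (∃ G, HasWeakGradient u G) ∧ MemLp (weakGradient u) 2 volume ∧
  ∃ φ : ℕ → Euc N → ℝ, (∀ n, IsRadialTest (φ n)) ∧
    Tendsto (fun n => eLpNorm (φ n - u) (critExp N) volume) atTop (𝓝 0) ∧
    Tendsto (fun n => eLpNorm (gradient (φ n) - weakGradient u) 2 volume) atTop (𝓝 0)

/-- The Orlicz-Sobolev space `E`. -/
def MemE (V : ℝ → ℝ) (u : Euc N → ℝ) : Prop :=
  MemD u ∧ Integrable (fun x => V ‖x‖ * cv (u x) ^ 2) volume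

/-- The Orlicz norm `‖u‖_o = inf_{k > 0} (1/k) (1 + ∫ V(|x|) f(k u)² dx)`. -/
def orliczNorm (V : ℝ → ℝ) (u : Euc N → ℝ) : ℝ :=
  ⨅ k : Set.Ioi (0 : ℝ), (1 / (k : ℝ)) * (1 + ∫ x, V ‖x‖ * cv (k * u x) ^ 2)

/-- The norm of `E`. -/
def normE (V : ℝ → ℝ) (u : Euc N → ℝ) : ℝ := dirichletNorm u + orliczNorm V u

/-! ### Hypotheses -/

/-- Hypothesis (H) on the potentials. -/
def HypH (V K : ℝ → ℝ) : Prop :=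
  ContinuousOn V (Set.Ioi 0) ∧ (∀ r > 0, 0 ≤ V r) ∧
  ContinuousOn K (Set.Ioi 0) ∧ (∀ r > 0, 0 < K r) ∧
  ∃ C > 0, ∀ r ∈ Set.Ioo (0 : ℝ) 1, V r ≤ C / r ^ 2

/-- `sup { ∫_A K(|x|) |u|^q dx : u ∈ E, ‖u‖ = 1 }`, as an extended number. -/
def supOn (V K : ℝ → ℝ) (q : ℝ) (A : Set (Euc N)) : ℝ≥0∞ :=
  ⨆ (u : Euc N → ℝ) (_ : MemE V u) (_ : normE V u = 1),
    ∫⁻ x in A, ENNReal.ofReal (K ‖x‖ * |u x| ^ q)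

/-- The quantity `S₀(q, R)`. -/
def S0 (N : ℕ) (V K : ℝ → ℝ) (q R : ℝ) : ℝ≥0∞ := supOn V K q (Metric.ball (0 : Euc N) R)

/-- The quantity `S_∞(q, R)`. -/
def SInf (N : ℕ) (V K : ℝ → ℝ) (q R : ℝ) : ℝ≥0∞ := supOn V K q (Metric.ball (0 : Euc N) R)ᶜ

/-- The condition `(S'_{q₁,q₂})`. -/
def CondS' (N : ℕ) (V K : ℝ → ℝ) (q₁ q₂ : ℝ) : Prop :=
  ∃ R₁ > 0, ∃ R₂ > 0, S0 N V K q₁ R₁ < ⊤ ∧ SInf N V K q₂ R₂ < ⊤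

/-- `G(t) = ∫₀ᵗ g`. -/
def primitive (g : ℝ → ℝ) (t : ℝ) : ℝ := ∫ s in (0 : ℝ)..t, g s

/-- Hypothesis (g₁). -/
def HypG1 (g : ℝ → ℝ) : Prop :=
  ∃ θ > 2, ∀ t, 0 ≤ 2 * θ * primitive g t ∧ 2 * θ * primitive g t ≤ g t * t

/-- Hypothesis (g₂). -/
def HypG2 (g : ℝ → ℝ) : Prop := ∃ t₀ > 0, 0 < primitive g t₀

/-- The double-power growth condition. -/
def HypGrowth (g : ℝ → ℝ) (q₁ q₂ : ℝ) : Prop :=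
  ∃ C > 0, ∀ t, |g t| ≤ C * min (|t| ^ (q₁ - 1)) (|t| ^ (q₂ - 1))

/-! ### The functional and its critical points -/

/-- The functional `I`. -/
def functional (V K g : ℝ → ℝ) (u : Euc N → ℝ) : ℝ :=
  1 / 2 * (∫ x, ‖weakGradient u x‖ ^ 2) + 1 / 2 * (∫ x, V ‖x‖ * cv (u x) ^ 2)
    - ∫ x, K ‖x‖ * primitive g (cv (u x))

/-- `u ∈ E` is a critical point of `I : E → ℝ`: the Fréchet derivative of `I` at `u`, with
respect to the norm of `E`, exists and is zero. -/
def IsCriticalPoint (V K g : ℝ → ℝ) (u : Euc N → ℝ) : Prop :=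
  MemE V u ∧ ∀ ε > 0, ∃ δ > 0, ∀ h : Euc N → ℝ, MemE V h → normE V h < δ →
    |functional V K g (u + h) - functional V K g u| ≤ ε * normE V h

end

end QSchrodinger

namespace QSchrodinger

noncomputable section

variable {N : ℕ}

/-! ### Elementary properties of the change of variable -/

/-! The problem reduces to an ordinary differential equation. A function in the radial space agrees
a.e. with `w ‖x‖`, where `w` is continuous on `(0, ∞)` (`MemD.exists_continuousOn`, from the radial
lemma `exists_radial_bound`). Since the solution is radial, it suffices to test with `ψ ‖x‖`, `ψ`
smooth with compact support in `(0, ∞)`; no principle of symmetric criticality is needed.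

On the support of such a `ψ` all coefficients and `w` are bounded, so dominated convergence
differentiates `I` along `ψ ‖x‖` (`hasDerivAt_functional`), once the integral of `K G(f(u))` is
known to converge. This is the role of the two suprema and the double-power growth
(`integrable_primitive`). Criticality makes the derivative zero. Moving both derivatives onto the
test function and passing to polar coordinates gives, with `H` the reaction term, `∫ w (r^(N-1) ψ')'
= ∫ r^(N-1) H ψ` (`IsCriticalPoint.radial_weak_equation`).

As `w`, hence `H`, is already continuous, two quadratures give a classical solution `z` of `(r^(N-1)
z')' = r^(N-1) H`. The difference `w - z` annihilates every `(r^(N-1) ψ')'`, and these are exactly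
the profiles orthogonal to the two homogeneous solutions, so `w - z` is a combination of those
solutions (`radial_regularity`). Thus `w` is `C²`, and the formula for the Laplacian of a radial
function (`laplacian_comp_norm`) turns the radial equation into the stated one. -/

theorem cv_zero : cv 0 = 0 := cv_spec.1

theorem hasDerivAt_cv (t : ℝ) : HasDerivAt cv (1 / Real.sqrt (1 + 2 * cv t ^ 2)) t := cv_spec.2 t

theorem continuous_cv : Continuous cv :=
  continuous_iff_continuousAt.2 fun t => (hasDerivAt_cv t).continuousAt

theorem deriv_cv : deriv cv = fun t => 1 / Real.sqrt (1 + 2 * cv t ^ 2) :=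
  funext fun t => (hasDerivAt_cv t).deriv

theorem one_le_sqrt_cv (s : ℝ) : 1 ≤ Real.sqrt (1 + 2 * s ^ 2) := by
  rw [Real.one_le_sqrt]; nlinarith [sq_nonneg s]

theorem continuous_deriv_cv : Continuous (deriv cv) := by
  rw [deriv_cv]
  have := continuous_cv
  refine continuous_const.div (by fun_prop) fun t => ?_
  linarith [one_le_sqrt_cv (cv t)]

theorem deriv_cv_pos (t : ℝ) : 0 < deriv cv t := by
  rw [deriv_cv]
  have := one_le_sqrt_cv (cv t)
  positivity

theorem deriv_cv_le_one (t : ℝ) : deriv cv t ≤ 1 := by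
  rw [deriv_cv]
  have := one_le_sqrt_cv (cv t)
  rw [div_le_one (by linarith)]
  exact this

theorem strictMono_cv : StrictMono cv := strictMono_of_deriv_pos deriv_cv_pos

theorem abs_cv_mul_le_of_le_one {c : ℝ} (hc : 0 ≤ c) (hc1 : c ≤ 1) (t : ℝ) :
    |cv (c * t)| ≤ |cv t| := by
  rcases le_total 0 t with ht | ht
  · have h1 : 0 ≤ cv (c * t) := cv_zero ▸ strictMono_cv.monotone (by positivity)
    have h2 : cv (c * t) ≤ cv t := strictMono_cv.monotone (by nlinarith)
    rw [abs_of_nonneg h1, abs_of_nonneg (h1.trans h2)]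
    exact h2
  · have h1 : cv (c * t) ≤ 0 := by
      have := strictMono_cv.monotone (show c * t ≤ 0 by nlinarith)
      rwa [cv_zero] at this
    have h2 : cv t ≤ cv (c * t) := strictMono_cv.monotone (by nlinarith)
    rw [abs_of_nonpos h1, abs_of_nonpos (h2.trans h1)]
    linarith

/-- The difference `c f(t) - f(ct)` vanishes at `0` and has derivative `c (f'(t) - f'(ct)) ≥ 0`,
because `f'` decreases as `|f|` grows. -/
theorem abs_cv_mul_le_of_one_le {c : ℝ} (hc : 1 ≤ c) (t : ℝ) : |cv (c * t)| ≤ c * |cv t| := by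
  have hmono : Monotone fun t => c * cv t - cv (c * t) := by
    have hd : ∀ t, HasDerivAt (fun t => c * cv t - cv (c * t))
        (c * deriv cv t - deriv cv (c * t) * c) t := fun t => by
      rw [deriv_cv]
      exact ((hasDerivAt_cv t).const_mul c).sub
        ((hasDerivAt_cv (c * t)).comp t (by simpa using (hasDerivAt_id t).const_mul c))
    refine monotone_of_deriv_nonneg (fun t => (hd t).differentiableAt) fun t => ?_
    rw [(hd t).deriv]
    suffices h : deriv cv (c * t) ≤ deriv cv t by nlinarith
    have h0 := abs_cv_mul_le_of_le_one (c := c⁻¹) (by positivity)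
      (inv_le_one_of_one_le₀ hc) (c * t)
    rw [inv_mul_cancel_left₀ (by positivity)] at h0
    have h0 := sq_le_sq' (by linarith [neg_abs_le (cv t), abs_nonneg (cv t)]) h0
    rw [deriv_cv]
    refine one_div_le_one_div_of_le (by linarith [one_le_sqrt_cv (cv t)]) (Real.sqrt_le_sqrt ?_)
    simp only [sq_abs] at h0
    linarith
  have hz : c * cv 0 - cv (c * 0) = 0 := by simp [cv_zero]
  rcases le_total 0 t with ht | ht
  · have h1 : 0 ≤ cv (c * t) := cv_zero ▸ strictMono_cv.monotone (by positivity)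
    have h2 : 0 ≤ cv t := cv_zero ▸ strictMono_cv.monotone ht
    have := hmono ht
    simp only [hz] at this
    rw [abs_of_nonneg h1, abs_of_nonneg h2]
    linarith
  · have h1 : cv (c * t) ≤ 0 := cv_zero ▸ strictMono_cv.monotone (by nlinarith)
    have h2 : cv t ≤ 0 := cv_zero ▸ strictMono_cv.monotone ht
    have := hmono ht
    simp only [hz] at this
    rw [abs_of_nonpos h1, abs_of_nonpos h2]
    linarith

theorem abs_cv_le (t : ℝ) : |cv t| ≤ |t| := by
  have h := Convex.norm_image_sub_le_of_norm_deriv_le (f := cv) (C := 1) (s := Set.univ) (x := 0)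
    (y := t) (fun x _ => (hasDerivAt_cv x).differentiableAt)
    (fun x _ => by
      rw [Real.norm_eq_abs, abs_of_pos (deriv_cv_pos x)]
      exact deriv_cv_le_one x) convex_univ trivial trivial
  simpa [cv_zero] using h

/-- A doubling-type bound: it makes `E` stable under nonnegative scaling. -/
theorem cv_mul_sq_le {c : ℝ} (hc : 0 ≤ c) (t : ℝ) :
    cv (c * t) ^ 2 ≤ max 1 c ^ 2 * cv t ^ 2 := by
  have h : |cv (c * t)| ≤ max 1 c * |cv t| := by
    rcases le_total c 1 with h | h
    · rw [max_eq_left h, one_mul]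
      exact abs_cv_mul_le_of_le_one hc h t
    · rw [max_eq_right h]
      exact abs_cv_mul_le_of_one_le h t
  rw [← mul_pow, ← sq_abs (cv (c * t)), ← sq_abs (max 1 c * cv t), abs_mul,
    abs_of_nonneg (a := max 1 c) (by positivity)]
  gcongr

/-! ### The primitive of the nonlinearity -/

theorem hasDerivAt_primitive {g : ℝ → ℝ} (hg : Continuous g) (t : ℝ) :
    HasDerivAt (primitive g) (g t) t :=
  hg.integral_hasStrictDerivAt 0 t |>.hasDerivAt

theorem continuous_primitive {g : ℝ → ℝ} (hg : Continuous g) : Continuous (primitive g) :=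
  continuous_iff_continuousAt.2 fun t => (hasDerivAt_primitive hg t).continuousAt

theorem primitive_zero (g : ℝ → ℝ) : primitive g 0 = 0 := by simp [primitive]

theorem abs_primitive_le {g : ℝ → ℝ} {C q : ℝ} (hC : 0 ≤ C) (hq : 1 < q)
    (h : ∀ t, |g t| ≤ C * |t| ^ (q - 1)) (t : ℝ) : |primitive g t| ≤ C * |t| ^ q := by
  have h1 : ‖∫ s in (0 : ℝ)..t, g s‖ ≤ C * |t| ^ (q - 1) * |t - 0| := by
    refine intervalIntegral.norm_integral_le_of_norm_le_const fun s hs => ?_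
    have hs' : |s| ≤ |t| := by
      rcases Set.mem_uIoc.1 hs with ⟨h1, h2⟩ | ⟨h1, h2⟩
      · rw [abs_of_pos h1, abs_of_pos (h1.trans_le h2)]; exact h2
      · rw [abs_of_nonpos h2, abs_of_neg (h1.trans_le h2)]; linarith
    refine (h s).trans ?_
    gcongr
  rw [sub_zero, mul_assoc] at h1
  rcases eq_or_ne t 0 with rfl | ht
  · simp [primitive, Real.zero_rpow (show q ≠ 0 by linarith)]
  · refine h1.trans (le_of_eq ?_)
    nth_rewrite 2 [← Real.rpow_one |t|]
    rw [← Real.rpow_add (abs_pos.2 ht), sub_add_cancel]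

/-! ### Weak gradients -/

theorem hasWeakGradient_weakGradient {u : Euc N → ℝ} (h : ∃ G, HasWeakGradient u G) :
    HasWeakGradient u (weakGradient u) := by
  rw [weakGradient, dif_pos h]
  exact h.choose_spec

/-- By the fundamental lemma of the calculus of variations. `weakGradient` is picked by choice, so
every computation with it goes through this uniqueness. -/
theorem HasWeakGradient.ae_unique {u : Euc N → ℝ} {G₁ G₂ : Euc N → Euc N}
    (h₁ : HasWeakGradient u G₁) (h₂ : HasWeakGradient u G₂) : G₁ =ᵐ[volume] G₂ := by
  have h := ae_eq_zero_of_integral_contDiff_smul_eq_zero (μ := (volume : Measure (Euc N)))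
    (h₁.2.1.sub h₂.2.1) fun φ hφ hφc => by
      have i₁ := h₁.2.1.integrable_smul_left_of_hasCompactSupport hφ.continuous hφc
      have i₂ := h₂.2.1.integrable_smul_left_of_hasCompactSupport hφ.continuous hφc
      simp only [Pi.sub_apply, smul_sub]
      rw [integral_sub i₁ i₂]
      have e₁ := h₁.2.2 φ hφ hφc
      have e₂ := h₂.2.2 φ hφ hφc
      rw [e₁] at e₂
      rw [neg_injective e₂, sub_self]
  filter_upwards [h] with x hx
  exact sub_eq_zero.1 hx

theorem HasWeakGradient.weakGradient_ae_eq {u : Euc N → ℝ} {G : Euc N → Euc N}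
    (h : HasWeakGradient u G) : weakGradient u =ᵐ[volume] G :=
  (hasWeakGradient_weakGradient ⟨G, h⟩).ae_unique h

theorem continuous_gradient {φ : Euc N → ℝ} {n : ℕ∞ω} (hφ : ContDiff ℝ n φ) (hn : n ≠ 0) :
    Continuous (gradient φ) :=
  (InnerProductSpace.toDual ℝ (Euc N)).symm.continuous.comp (hφ.continuous_fderiv hn)

theorem HasCompactSupport.gradient {φ : Euc N → ℝ} (hφ : HasCompactSupport φ) :
    HasCompactSupport (gradient φ) :=
  (hφ.fderiv ℝ).comp_left (g := (InnerProductSpace.toDual ℝ (Euc N)).symm) (map_zero _)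

theorem HasWeakGradient.add {u v : Euc N → ℝ} {G H : Euc N → Euc N}
    (hu : HasWeakGradient u G) (hv : HasWeakGradient v H) : HasWeakGradient (u + v) (G + H) := by
  refine ⟨hu.1.add hv.1, hu.2.1.add hv.2.1, fun φ hφ hφc => ?_⟩
  have c := continuous_gradient hφ (by simp)
  have cs := HasCompactSupport.gradient hφc
  simp only [Pi.add_apply, add_smul, smul_add]
  rw [integral_add (hu.1.integrable_smul_right_of_hasCompactSupport c cs)
    (hv.1.integrable_smul_right_of_hasCompactSupport c cs),
    integral_add (hu.2.1.integrable_smul_left_of_hasCompactSupport hφ.continuous hφc)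
    (hv.2.1.integrable_smul_left_of_hasCompactSupport hφ.continuous hφc),
    hu.2.2 φ hφ hφc, hv.2.2 φ hφ hφc, neg_add]

theorem HasWeakGradient.const_smul {u : Euc N → ℝ} {G : Euc N → Euc N}
    (hu : HasWeakGradient u G) (c : ℝ) : HasWeakGradient (c • u) (c • G) := by
  refine ⟨hu.1.smul c, hu.2.1.smul c, fun φ hφ hφc => ?_⟩
  simp only [Pi.smul_apply, smul_eq_mul, mul_smul]
  rw [integral_smul, hu.2.2 φ hφ hφc]
  simp_rw [smul_comm _ c]
  rw [integral_smul, smul_neg]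

theorem hasWeakGradient_of_contDiff {φ : Euc N → ℝ} (hφ : ContDiff ℝ 1 φ) :
    HasWeakGradient φ (gradient φ) := by
  have cφ := continuous_gradient hφ one_ne_zero
  refine ⟨hφ.continuous.locallyIntegrable, cφ.locallyIntegrable, fun η hη hηc => ?_⟩
  have cη := continuous_gradient hη (by simp)
  have csη := HasCompactSupport.gradient hηc
  have i₁ : Integrable (fun x => φ x • gradient η x) :=
    (hφ.continuous.smul cη).integrable_of_hasCompactSupport csη.smul_left
  have i₂ : Integrable (fun x => η x • gradient φ x) :=
    (hη.continuous.smul cφ).integrable_of_hasCompactSupport hηc.smul_right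
  -- Pairing with a fixed vector `e` reduces the vector identity to scalar integration by parts in
  -- the direction `e`.
  refine ext_inner_right ℝ fun e => ?_
  rw [inner_neg_left, real_inner_comm, ← integral_inner i₁, real_inner_comm, ← integral_inner i₂]
  simp only [inner_smul_right, inner_gradient_right, conj_trivial]
  have h := integral_mul_fderiv_eq_neg_fderiv_mul_of_integrable (μ := (volume : Measure (Euc N)))
    (f := φ) (g := η) (v := e) ?_ ?_ ?_ (fun x _ => hφ.differentiable one_ne_zero x)
    (fun x _ => hη.differentiable (by simp) x)
  · rw [h]; simp only [mul_comm]
  · exact ((hφ.continuous_fderiv_apply one_ne_zero |>.comp (Continuous.prodMk_left e)).mul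
      hη.continuous).integrable_of_hasCompactSupport hηc.mul_left
  · exact (hφ.continuous.mul (hη.continuous_fderiv_apply (by simp) |>.comp
      (Continuous.prodMk_left e))).integrable_of_hasCompactSupport
      ((hηc.fderiv_apply (𝕜 := ℝ) e).mul_left)
  · exact (hφ.continuous.mul hη.continuous).integrable_of_hasCompactSupport hηc.mul_left

theorem gradient_const_smul {φ : Euc N → ℝ} (c : ℝ) (hφ : Differentiable ℝ φ) :
    gradient (c • φ) = c • gradient φ := by
  funext x
  simp [gradient, fderiv_const_smul (hφ x)]

/-! ### Scaling in the space `E` -/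

theorem MemD.hasWeakGradient {u : Euc N → ℝ} (hu : MemD u) :
    HasWeakGradient u (weakGradient u) := hasWeakGradient_weakGradient hu.2.1

theorem MemD.weakGradient_const_smul {u : Euc N → ℝ} (hu : MemD u) (c : ℝ) :
    weakGradient (c • u) =ᵐ[volume] c • weakGradient u :=
  (hu.hasWeakGradient.const_smul c).weakGradient_ae_eq

theorem IsRadialTest.const_smul {φ : Euc N → ℝ} (hφ : IsRadialTest φ) (c : ℝ) :
    IsRadialTest (c • φ) :=
  ⟨hφ.1.const_smul c, hφ.2.1.smul_left (f := fun _ => c), fun x y h => by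
    simp [hφ.2.2 x y h]⟩

theorem tendsto_eLpNorm_const_smul {E F : Type*} [MeasurableSpace E] [NormedAddCommGroup F]
    [NormedSpace ℝ F] {μ : Measure E} {p : ℝ≥0∞} {φ : ℕ → E → F} {ψ : ℕ → E → F} (c : ℝ)
    (h : Tendsto (fun n => eLpNorm (φ n) p μ) atTop (𝓝 0)) (e : ∀ n, ψ n =ᵐ[μ] c • φ n) :
    Tendsto (fun n => eLpNorm (ψ n) p μ) atTop (𝓝 0) := by
  have h1 := ENNReal.Tendsto.const_mul (a := ‖c‖ₑ) h (Or.inr enorm_ne_top)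
  rw [mul_zero] at h1
  refine h1.congr fun n => ?_
  rw [eLpNorm_congr_ae (e n), eLpNorm_const_smul]

theorem MemD.const_smul {u : Euc N → ℝ} (hu : MemD u) (c : ℝ) : MemD (c • u) := by
  have hw := hu.weakGradient_const_smul c
  obtain ⟨φ, hφ, h1, h2⟩ := hu.2.2.2
  refine ⟨hu.1.const_smul c, ⟨_, hu.hasWeakGradient.const_smul c⟩,
    (memLp_congr_ae hw).2 (hu.2.2.1.const_smul c), fun n => c • φ n,
    fun n => (hφ n).const_smul c, tendsto_eLpNorm_const_smul c h1 fun n => ?_,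
    tendsto_eLpNorm_const_smul c h2 fun n => ?_⟩
  · rw [smul_sub]
  · rw [gradient_const_smul c ((hφ n).1.differentiable (by simp)), smul_sub]
    exact EventuallyEq.rfl.sub hw

theorem dirichletNorm_const_smul {u : Euc N → ℝ} (hu : MemD u) {c : ℝ} (hc : 0 ≤ c) :
    dirichletNorm (c • u) = c * dirichletNorm u := by
  have h : ∫ x, ‖weakGradient (c • u) x‖ ^ 2 = c ^ 2 * ∫ x, ‖weakGradient u x‖ ^ 2 := by
    rw [← integral_const_mul]
    refine integral_congr_ae ?_
    filter_upwards [hu.weakGradient_const_smul c] with x hx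
    rw [hx, Pi.smul_apply, norm_smul, mul_pow, Real.norm_eq_abs, sq_abs]
  rw [dirichletNorm, h, Real.sqrt_mul (sq_nonneg c), Real.sqrt_sq hc, dirichletNorm]

/-- Exact homogeneity comes from substituting `c * k` for `k` in the infimum; nothing about `f` is
involved. -/
theorem orliczNorm_const_smul (V : ℝ → ℝ) (u : Euc N → ℝ) {c : ℝ} (hc : 0 < c) :
    orliczNorm V (c • u) = c * orliczNorm V u := by
  rw [orliczNorm, orliczNorm, Real.mul_iInf_of_nonneg hc.le]
  let e : Set.Ioi (0 : ℝ) ≃ Set.Ioi (0 : ℝ) :=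
    { toFun := fun k => ⟨c * k, mul_pos hc k.2⟩
      invFun := fun k => ⟨c⁻¹ * k, mul_pos (inv_pos.2 hc) k.2⟩
      left_inv := fun k => Subtype.ext (inv_mul_cancel_left₀ hc.ne' _)
      right_inv := fun k => Subtype.ext (mul_inv_cancel_left₀ hc.ne' _) }
  refine e.iInf_congr fun k => ?_
  have hk : (k : ℝ) ≠ 0 := (Set.mem_Ioi.1 k.2).ne'
  have h : ∀ x : Euc N, (e k : ℝ) * u x = k * (c • u) x := fun x => by
    simp only [e, Equiv.coe_fn_mk, Pi.smul_apply, smul_eq_mul]; ring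
  simp only [h]
  simp only [e, Equiv.coe_fn_mk]
  field_simp

theorem nontrivial_euc (hN : 0 < N) : Nontrivial (Euc N) :=
  have : Nonempty (Fin N) := ⟨⟨0, hN⟩⟩
  inferInstance

theorem ae_ne_zero (hN : 0 < N) : ∀ᵐ x : Euc N, x ≠ 0 := by
  have := nontrivial_euc hN
  exact compl_mem_ae_iff.2 (measure_singleton (0 : Euc N))

theorem orliczNorm_nonneg {V : ℝ → ℝ} (hV : ∀ r > 0, 0 ≤ V r) (hN : 0 < N) (u : Euc N → ℝ) :
    0 ≤ orliczNorm V u := by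
  refine Real.iInf_nonneg fun k => mul_nonneg (one_div_nonneg.2 (Set.mem_Ioi.1 k.2).le) ?_
  refine add_nonneg zero_le_one (integral_nonneg_of_ae ?_)
  filter_upwards [ae_ne_zero hN] with x hx
  exact mul_nonneg (hV _ (norm_pos_iff.2 hx)) (sq_nonneg _)

theorem normE_nonneg {V : ℝ → ℝ} (hV : ∀ r > 0, 0 ≤ V r) (hN : 0 < N) (u : Euc N → ℝ) :
    0 ≤ normE V u :=
  add_nonneg (Real.sqrt_nonneg _) (orliczNorm_nonneg hV hN u)

theorem normE_const_smul (V : ℝ → ℝ) {u : Euc N → ℝ} (hu : MemD u) {c : ℝ} (hc : 0 < c) :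
    normE V (c • u) = c * normE V u := by
  rw [normE, normE, dirichletNorm_const_smul hu hc.le, orliczNorm_const_smul V u hc, mul_add]

theorem continuousOn_comp_norm {h : ℝ → ℝ} (hh : ContinuousOn h (Set.Ioi 0)) :
    ContinuousOn (fun x : Euc N => h ‖x‖) {0}ᶜ :=
  hh.comp continuous_norm.continuousOn fun _ hx => norm_pos_iff.2 hx

theorem aestronglyMeasurable_comp_norm (hN : 0 < N) {h : ℝ → ℝ} (hh : ContinuousOn h (Set.Ioi 0)) :
    AEStronglyMeasurable (fun x : Euc N => h ‖x‖) volume := by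
  have h1 := (continuousOn_comp_norm (N := N) hh).aestronglyMeasurable (μ := volume)
    (measurableSet_singleton (0 : Euc N)).compl
  rwa [Measure.restrict_eq_self_of_ae_mem (s := {0}ᶜ) (ae_ne_zero hN)] at h1

theorem MemE.const_smul {V : ℝ → ℝ} (hVc : ContinuousOn V (Set.Ioi 0)) (hV : ∀ r > 0, 0 ≤ V r)
    (hN : 0 < N) {u : Euc N → ℝ} (hu : MemE V u) {c : ℝ} (hc : 0 ≤ c) : MemE V (c • u) := by
  refine ⟨hu.1.const_smul c, (hu.2.const_mul (max 1 c ^ 2)).mono' ?_ ?_⟩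
  · exact (aestronglyMeasurable_comp_norm hN hVc).mul
      ((continuous_cv.comp_aestronglyMeasurable (hu.1.1.aestronglyMeasurable.const_smul c)).pow 2)
  · filter_upwards [ae_ne_zero hN] with x hx
    have hVx := hV _ (norm_pos_iff.2 hx)
    rw [Real.norm_of_nonneg (mul_nonneg hVx (sq_nonneg _)), mul_left_comm]
    exact mul_le_mul_of_nonneg_left (cv_mul_sq_le hc _) hVx

/-! ### Radial functions -/

theorem exists_norm_eq_one (hN : 0 < N) : ∃ e : Euc N, ‖e‖ = 1 := by
  have := nontrivial_euc hN
  exact exists_norm_eq (Euc N) zero_le_one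

/-- The area of the unit sphere. -/
def sphereArea (N : ℕ) : ℝ := N * (volume : Measure (Euc N)).real (Metric.ball 0 1)

theorem sphereArea_pos (hN : 0 < N) : 0 < sphereArea N := by
  have h : 0 < (volume : Measure (Euc N)).real (Metric.ball 0 1) :=
    ENNReal.toReal_pos (Metric.measure_ball_pos _ _ one_pos).ne' measure_ball_lt_top.ne
  have : (0 : ℝ) < N := by exact_mod_cast hN
  exact mul_pos this h

theorem integral_comp_norm (hN : 0 < N) (h : ℝ → ℝ) :
    ∫ x : Euc N, h ‖x‖ = sphereArea N * ∫ r in Set.Ioi (0 : ℝ), r ^ (N - 1) * h r := by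
  have := nontrivial_euc hN
  rw [integral_fun_norm_addHaar]
  simp [sphereArea, mul_assoc]

theorem integrable_comp_norm (hN : 0 < N) {h : ℝ → ℝ} :
    Integrable (fun x : Euc N => h ‖x‖) ↔
      IntegrableOn (fun r => r ^ (N - 1) * h r) (Set.Ioi (0 : ℝ)) := by
  have := nontrivial_euc hN
  rw [integrable_fun_norm_addHaar]
  simp

theorem integral_sq_eq_eLpNorm {G : Euc N → Euc N} (hG : MemLp G 2 volume) :
    Real.sqrt (∫ x, ‖G x‖ ^ 2) = (eLpNorm G 2 volume).toReal := by
  rw [hG.eLpNorm_eq_integral_rpow_norm two_ne_zero ENNReal.ofNat_ne_top, ENNReal.toReal_ofReal]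
  · simp [Real.sqrt_eq_rpow]
  · positivity

theorem IsRadialTest.memLp_gradient {φ : Euc N → ℝ} (hφ : IsRadialTest φ) :
    MemLp (gradient φ) 2 volume :=
  (continuous_gradient hφ.1 (by simp)).memLp_of_hasCompactSupport
    (HasCompactSupport.gradient hφ.2.1)

/-- The restriction of a radial function to a ray. -/
theorem IsRadialTest.comp_ray {φ : Euc N → ℝ} (hφ : IsRadialTest φ) {e : Euc N} (he : ‖e‖ = 1) :
    ContDiff ℝ ∞ (fun r : ℝ => φ (r • e)) ∧ HasCompactSupport (fun r : ℝ => φ (r • e)) := by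
  refine ⟨hφ.1.comp (contDiff_id.smul contDiff_const), ?_⟩
  have hi : Isometry fun r : ℝ => r • e := Isometry.of_dist_eq fun a b => by
    rw [dist_eq_norm, ← sub_smul, norm_smul, he, mul_one, dist_eq_norm]
  exact hφ.2.1.comp_isClosedEmbedding hi.isClosedEmbedding

/-- By radiality the ray along `e` may be replaced by the ray through `x`, on which the derivative
is a directional derivative of `φ` at `x` along a unit vector. -/
theorem IsRadialTest.abs_deriv_ray_le {φ : Euc N → ℝ} (hφ : IsRadialTest φ) {e : Euc N}
    (he : ‖e‖ = 1) {x : Euc N} (hx : x ≠ 0) :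
    |deriv (fun r : ℝ => φ (r • e)) ‖x‖| ≤ ‖gradient φ x‖ := by
  have hx' : ‖x‖ ≠ 0 := norm_ne_zero_iff.2 hx
  set y : Euc N := ‖x‖⁻¹ • x with hy
  have hyn : ‖y‖ = 1 := by rw [hy, norm_smul, norm_inv, norm_norm, inv_mul_cancel₀ hx']
  have h1 : (fun r : ℝ => φ (r • e)) = fun r : ℝ => φ (r • y) :=
    funext fun r => hφ.2.2 _ _ (by rw [norm_smul, norm_smul, he, hyn])
  have hxy : ‖x‖ • y = x := by rw [hy, smul_inv_smul₀ hx']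
  have h2 : HasDerivAt (fun r : ℝ => φ (r • y)) (fderiv ℝ φ x y) ‖x‖ := by
    have h3 : HasFDerivAt φ (fderiv ℝ φ x) (‖x‖ • y) := by
      rw [hxy]; exact (hφ.1.differentiable (by simp) x).hasFDerivAt
    have h4 := h3.comp_hasDerivAt ‖x‖ ((hasDerivAt_id ‖x‖).smul_const y)
    rwa [one_smul] at h4
  rw [h1, h2.deriv, ← inner_gradient_left]
  exact (abs_real_inner_le_norm _ _).trans (by rw [hyn, mul_one])

/-- The radial lemma, away from the origin. -/
theorem exists_radial_bound (hN : 3 ≤ N) {a : ℝ} (ha : 0 < a) : ∃ C : ℝ, ∀ φ : Euc N → ℝ,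
    IsRadialTest φ → ∀ x, a ≤ ‖x‖ → |φ x| ≤ C * (eLpNorm (gradient φ) 2 volume).toReal := by
  have hN0 : 0 < N := by omega
  obtain ⟨e, he⟩ := exists_norm_eq_one hN0
  -- This weight cancels the polar Jacobian, so that `∫_a^∞ |ψ'|` becomes an integral over `ℝᴺ` to
  -- which Cauchy–Schwarz applies. It is square integrable because `r^(-(N-1))` is integrable at
  -- infinity when `N ≥ 3`.
  set m : ℝ → ℝ := (Set.Ioi a).indicator fun r => (r ^ (N - 1))⁻¹ with hm
  have hm0 : ∀ r, 0 ≤ m r := fun r => Set.indicator_nonneg (fun s hs => by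
    have : 0 < s := ha.trans hs
    positivity) r
  have hmm : Measurable m := by
    refine Measurable.indicator ?_ measurableSet_Ioi
    fun_prop
  have hmL : MemLp (fun x : Euc N => m ‖x‖) 2 volume := by
    refine (memLp_two_iff_integrable_sq (hmm.comp measurable_norm).aestronglyMeasurable).2 ?_
    refine (integrable_comp_norm hN0 (h := fun r => m r ^ 2)).2 ?_
    have h1 : IntegrableOn (fun r : ℝ => r ^ (-(N - 1 : ℝ))) (Set.Ioi a) := by
      refine integrableOn_Ioi_rpow_of_lt ?_ ha
      have : (3 : ℝ) ≤ N := by exact_mod_cast hN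
      linarith
    have h2 : (fun r => r ^ (N - 1) * m r ^ 2) =
        (Set.Ioi a).indicator fun r : ℝ => r ^ (-(N - 1 : ℝ)) := by
      funext r
      by_cases hr : r ∈ Set.Ioi a
      · have hr0 : 0 < r := ha.trans hr
        rw [hm, Set.indicator_of_mem hr, Set.indicator_of_mem hr, Real.rpow_neg hr0.le,
          show (N - 1 : ℝ) = ((N - 1 : ℕ) : ℝ) by rw [Nat.cast_sub (by omega)]; simp,
          Real.rpow_natCast]
        field_simp
      · simp [hm, Set.indicator_of_notMem hr]
    rw [h2]
    exact (h1.integrable_indicator measurableSet_Ioi).integrableOn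
  refine ⟨(sphereArea N)⁻¹ * (∫ x : Euc N, m ‖x‖ ^ (2 : ℝ)) ^ (1 / (2 : ℝ)),
    fun φ hφ x hx => ?_⟩
  set ψ : ℝ → ℝ := fun r => φ (r • e) with hψ
  obtain ⟨hψc, hψs⟩ := hφ.comp_ray he
  have hdc : Continuous (deriv ψ) := hψc.continuous_deriv (by simp)
  have hdi : Integrable (fun r => |deriv ψ r|) :=
    (hdc.integrable_of_hasCompactSupport hψs.deriv).abs
  have e1 : φ x = ψ ‖x‖ := hφ.2.2 _ _ (by rw [norm_smul, he, mul_one, norm_norm])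
  have e2 : |φ x| ≤ ∫ r in Set.Ioi a, |deriv ψ r| := by
    -- Integrate `ψ'` from `‖x‖` to infinity, where `ψ` vanishes.
    rw [e1, ← abs_neg, ← hψs.integral_Ioi_deriv_eq (hψc.of_le (by simp))]
    refine (abs_integral_le_integral_abs).trans ?_
    exact setIntegral_mono_set hdi.integrableOn (ae_of_all _ fun _ => abs_nonneg _)
      (Set.Ioi_subset_Ioi hx).eventuallyLE
  have e3 : ∫ r in Set.Ioi a, |deriv ψ r| =
      ∫ r in Set.Ioi (0 : ℝ), r ^ (N - 1) * (m r * |deriv ψ r|) := by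
    have h1 : ∀ r, r ^ (N - 1) * (m r * |deriv ψ r|) =
        (Set.Ioi a).indicator (fun r => |deriv ψ r|) r := fun r => by
      by_cases hr : r ∈ Set.Ioi a
      · have hr0 : 0 < r := ha.trans hr
        rw [hm, Set.indicator_of_mem hr, Set.indicator_of_mem hr]
        field_simp
      · simp [hm, Set.indicator_of_notMem hr]
    simp only [h1]
    rw [setIntegral_indicator measurableSet_Ioi, Set.Ioi_inter_Ioi, sup_of_le_right ha.le]
  have e4 : ∫ x : Euc N, m ‖x‖ * |deriv ψ ‖x‖| ≤ ∫ x : Euc N, m ‖x‖ * ‖gradient φ x‖ := by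
    refine integral_mono_of_nonneg (ae_of_all _ fun x => mul_nonneg (hm0 _) (abs_nonneg _))
      (hmL.integrable_mul hφ.memLp_gradient.norm) ?_
    filter_upwards [ae_ne_zero hN0] with x hx
    exact mul_le_mul_of_nonneg_left (hφ.abs_deriv_ray_le he hx) (hm0 _)
  have e5 := integral_mul_le_Lp_mul_Lq_of_nonneg (μ := (volume : Measure (Euc N)))
    Real.HolderConjugate.two_two (f := fun x => m ‖x‖) (g := fun x => ‖gradient φ x‖)
    (ae_of_all _ fun x => hm0 _) (ae_of_all _ fun x => norm_nonneg _) (by simpa using hmL)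
    (by simpa using hφ.memLp_gradient.norm)
  have e6 : (∫ x, ‖gradient φ x‖ ^ (2 : ℝ)) ^ (1 / (2 : ℝ)) =
      (eLpNorm (gradient φ) 2 volume).toReal := by
    rw [← integral_sq_eq_eLpNorm hφ.memLp_gradient, Real.sqrt_eq_rpow]
    simp
  have hA := sphereArea_pos hN0
  have e7 := integral_comp_norm hN0 (fun r => m r * |deriv ψ r|)
  rw [← e3] at e7
  rw [e6] at e5
  rw [mul_assoc, ← div_eq_inv_mul, le_div_iff₀ hA, mul_comm]
  calc sphereArea N * |φ x| ≤ sphereArea N * ∫ r in Set.Ioi a, |deriv ψ r| := by gcongr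
    _ ≤ _ := by rw [← e7]; exact e4.trans e5

theorem IsRadialTest.sub {φ ψ : Euc N → ℝ} (hφ : IsRadialTest φ) (hψ : IsRadialTest ψ) :
    IsRadialTest (φ - ψ) :=
  ⟨hφ.1.sub hψ.1, hφ.2.1.sub hψ.2.1, fun x y h => by
    simp [hφ.2.2 x y h, hψ.2.2 x y h]⟩

theorem gradient_sub {φ ψ : Euc N → ℝ} (hφ : Differentiable ℝ φ) (hψ : Differentiable ℝ ψ) :
    gradient (φ - ψ) = gradient φ - gradient ψ := by
  funext x
  simp [gradient, fderiv_sub (hφ x) (hψ x)]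

/-- Functions of `D_r^{1,2}` are continuous radial functions away from the origin. -/
theorem MemD.exists_continuousOn (hN : 3 ≤ N) {u : Euc N → ℝ} (hu : MemD u) :
    ∃ w : ℝ → ℝ, ContinuousOn w (Set.Ioi 0) ∧ (u =ᵐ[volume] fun x => w ‖x‖) ∧
      (dirichletNorm u = 0 → ∀ r > 0, w r = 0) := by
  have hN0 : 0 < N := by omega
  obtain ⟨e, he⟩ := exists_norm_eq_one hN0
  obtain ⟨φ, hφ, h1, h2⟩ := hu.2.2.2
  have hGm := hu.2.2.1
  have hd : ∀ n, MemLp (gradient (φ n) - weakGradient u) 2 volume := fun n =>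
    (hφ n).memLp_gradient.sub hGm
  set d : ℕ → ℝ := fun n => (eLpNorm (gradient (φ n) - weakGradient u) 2 volume).toReal with hdd
  have hd0 : Tendsto d atTop (𝓝 0) := by
    have := (ENNReal.tendsto_toReal ENNReal.zero_ne_top).comp h2
    rwa [ENNReal.toReal_zero] at this
  -- The radial lemma applied to differences of approximants: convergence of gradients in `L²`
  -- forces uniform convergence on each `[a, ∞)`.
  have hbound : ∀ a : ℝ, a > 0 → ∃ C : ℝ, 0 ≤ C ∧ ∀ n m, ∀ r, a ≤ r →
      |φ n (r • e) - φ m (r • e)| ≤ C * (d n + d m) := by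
    intro a ha
    obtain ⟨C, hC⟩ := exists_radial_bound hN ha
    refine ⟨|C|, abs_nonneg C, fun n m r hr => ?_⟩
    have hr' : a ≤ ‖r • e‖ := by rwa [norm_smul, he, mul_one, Real.norm_of_nonneg (ha.le.trans hr)]
    refine (hC _ ((hφ n).sub (hφ m)) _ hr').trans ?_
    have h3 : (eLpNorm (gradient (φ n - φ m)) 2 volume).toReal ≤ d n + d m := by
      rw [gradient_sub ((hφ n).1.differentiable (by simp)) ((hφ m).1.differentiable (by simp)),
        ← sub_sub_sub_cancel_right _ _ (weakGradient u), hdd,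
        ← ENNReal.toReal_add (hd n).eLpNorm_ne_top (hd m).eLpNorm_ne_top]
      exact ENNReal.toReal_mono
        (ENNReal.add_ne_top.2 ⟨(hd n).eLpNorm_ne_top, (hd m).eLpNorm_ne_top⟩)
        (eLpNorm_sub_le (hd n).1 (hd m).1 one_le_two)
    calc C * _ ≤ |C| * (eLpNorm (gradient (φ n - φ m)) 2 volume).toReal := by
          gcongr; exact le_abs_self C
      _ ≤ _ := by gcongr
  have huc : ∀ a : ℝ, a > 0 → UniformCauchySeqOn (fun n r => φ n (r • e)) atTop (Set.Ici a) := by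
    intro a ha
    obtain ⟨C, hC0, hC⟩ := hbound a ha
    rw [Metric.uniformCauchySeqOn_iff]
    intro ε hε
    have h3 : ∀ᶠ n in atTop, C * d n < ε / 2 := by
      have := hd0.const_mul C
      rw [mul_zero] at this
      exact this.eventually_lt_const (by positivity)
    obtain ⟨n₀, hn₀⟩ := eventually_atTop.1 h3
    refine ⟨n₀, fun m hm n hn r hr => ?_⟩
    rw [Real.dist_eq]
    refine (hC m n r hr).trans_lt ?_
    linarith [hn₀ m hm, hn₀ n hn]
  have hlim : ∀ r : ℝ, ∃ l : ℝ, 0 < r → Tendsto (fun n => φ n (r • e)) atTop (𝓝 l) := fun r => by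
    by_cases hr : 0 < r
    · obtain ⟨l, hl⟩ := cauchySeq_tendsto_of_complete
        ((huc r hr).cauchySeq (x := r) Set.self_mem_Ici)
      exact ⟨l, fun _ => hl⟩
    · exact ⟨0, fun h => absurd h hr⟩
  choose w hw using hlim
  refine ⟨w, fun r hr => ?_, ?_, fun hz r hr => ?_⟩
  · have ha : 0 < r / 2 := half_pos hr
    have h3 : TendstoUniformlyOn (fun n r => φ n (r • e)) w atTop (Set.Ici (r / 2)) :=
      (huc _ ha).tendstoUniformlyOn_of_tendsto fun s hs => hw s (ha.trans_le hs)
    have h4 : ContinuousOn w (Set.Ici (r / 2)) :=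
      h3.continuousOn (Frequently.of_forall fun n => ((hφ n).comp_ray he).1.continuous.continuousOn)
    exact (h4.continuousAt (Ici_mem_nhds (half_lt_self hr))).continuousWithinAt
  -- The uniform limit is `u` itself: convergence in `L^{2*}` gives convergence in measure, hence
  -- a.e. along a subsequence.
  · have hp : critExp N ≠ 0 := by
      have : (3 : ℝ) ≤ N := by exact_mod_cast hN
      rw [critExp, Ne, ENNReal.ofReal_eq_zero, not_le]
      exact div_pos (by linarith) (by linarith)
    obtain ⟨ns, hns, h3⟩ := (tendstoInMeasure_of_tendsto_eLpNorm hp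
      (fun n => (hφ n).1.continuous.aestronglyMeasurable) hu.1.1 h1).exists_seq_tendsto_ae
    filter_upwards [h3, ae_ne_zero hN0] with x hx hx0
    refine tendsto_nhds_unique hx (((hw ‖x‖ (norm_pos_iff.2 hx0)).comp hns.tendsto_atTop).congr
      fun n => (hφ _).2.2 _ _ ?_)
    rw [norm_smul, he, mul_one, norm_norm]
  -- If the Dirichlet norm vanishes, the gradients of the approximants tend to `0` in `L²`, so the
  -- radial lemma forces the limit to be `0`. This serves the case of a function that cannot be
  -- normalised.
  · have hG0 : weakGradient u =ᵐ[volume] 0 := by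
      have h3 : eLpNorm (weakGradient u) 2 volume = 0 := by
        rw [dirichletNorm, integral_sq_eq_eLpNorm hGm, ENNReal.toReal_eq_zero_iff] at hz
        exact hz.resolve_right hGm.eLpNorm_ne_top
      rwa [eLpNorm_eq_zero_iff hGm.1 two_ne_zero] at h3
    obtain ⟨C, hC⟩ := exists_radial_bound hN hr
    refine tendsto_nhds_unique (hw r hr) (squeeze_zero_norm (a := fun n => C * d n) (fun n => ?_) ?_)
    · have h3 : eLpNorm (gradient (φ n) - weakGradient u) 2 volume =
          eLpNorm (gradient (φ n)) 2 volume := by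
        refine eLpNorm_congr_ae ?_
        filter_upwards [hG0] with x hx
        simp [hx]
      simp only [hdd, h3]
      refine hC _ (hφ n) _ ?_
      rw [norm_smul, he, mul_one, Real.norm_of_nonneg hr.le]
    · simpa using hd0.const_mul C

/-! ### The Laplacian of a radial function -/

theorem hasFDerivAt_norm_of_ne_zero {x : Euc N} (hx : x ≠ 0) :
    HasFDerivAt (fun y : Euc N => ‖y‖) (‖x‖⁻¹ • innerSL ℝ x) x := by
  have h1 := ((hasStrictFDerivAt_norm_sq x).hasFDerivAt).sqrt (pow_ne_zero 2 (norm_ne_zero_iff.2 hx))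
  simp only [Real.sqrt_sq (norm_nonneg _)] at h1
  have h2 : (1 / (2 * ‖x‖)) • (2 : ℝ) • innerSL ℝ x = ‖x‖⁻¹ • innerSL ℝ x := by
    rw [smul_smul]; congr 1; field_simp
  rw [← h2]
  simpa [ofNat_smul_eq_nsmul] using h1

theorem hasFDerivAt_comp_norm {w : ℝ → ℝ} {w' : ℝ} {x : Euc N} (hx : x ≠ 0)
    (hw : HasDerivAt w w' ‖x‖) :
    HasFDerivAt (fun y : Euc N => w ‖y‖) ((w' / ‖x‖) • innerSL ℝ x) x := by
  have h := hw.comp_hasFDerivAt x (hasFDerivAt_norm_of_ne_zero hx)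
  rwa [smul_smul, ← div_eq_mul_inv] at h

/-- The gradient is `(w₁(r)/r) x`. Differentiating this product, the second derivative in direction
`e` is `(w₁/r) |e|² + ((w₁/r)'/r) ⟨x, e⟩²`, and the sum over an orthonormal basis is `N w₁/r + r
(w₁/r)'`. -/
theorem laplacian_comp_norm {w w₁ : ℝ → ℝ} {w₂ : ℝ} {x : Euc N} (hx : x ≠ 0)
    (hw : ∀ r > 0, HasDerivAt w (w₁ r) r) (hw₁ : HasDerivAt w₁ w₂ ‖x‖) :
    (Δ (fun y : Euc N => w ‖y‖)) x = w₂ + (N - 1) / ‖x‖ * w₁ ‖x‖ := by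
  have hx' : ‖x‖ ≠ 0 := norm_ne_zero_iff.2 hx
  have h1 : fderiv ℝ (fun y : Euc N => w ‖y‖) =ᶠ[𝓝 x]
      fun y => (w₁ ‖y‖ / ‖y‖) • innerSL ℝ y := by
    filter_upwards [isOpen_ne.mem_nhds hx] with y hy
    exact (hasFDerivAt_comp_norm hy (hw _ (norm_pos_iff.2 hy))).fderiv
  have h2 : HasDerivAt (fun r => w₁ r / r) ((w₂ * ‖x‖ - w₁ ‖x‖ * 1) / ‖x‖ ^ 2) ‖x‖ :=
    hw₁.div (hasDerivAt_id _) hx'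
  have h3 := (hasFDerivAt_comp_norm hx h2).smul (innerSL ℝ (E := Euc N)).hasFDerivAt
  have h4 := (h3.congr_of_eventuallyEq h1).fderiv
  rw [InnerProductSpace.laplacian_eq_iteratedFDeriv_orthonormalBasis _
    (EuclideanSpace.basisFun (Fin N) ℝ)]
  have h7 : ∀ e : Euc N, fderiv ℝ (fderiv ℝ fun y : Euc N => w ‖y‖) x e e =
      w₁ ‖x‖ / ‖x‖ * inner ℝ e e +
        (w₂ * ‖x‖ - w₁ ‖x‖ * 1) / ‖x‖ ^ 2 / ‖x‖ * (inner ℝ x e * inner ℝ x e) := fun e => by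
    rw [h4, ← mul_assoc]; rfl
  simp only [iteratedFDeriv_two_apply, Matrix.cons_val_zero, Matrix.cons_val_one, h7,
    Finset.sum_add_distrib]
  have h5 := (EuclideanSpace.basisFun (Fin N) ℝ).sum_inner_mul_inner x x
  have h6 : ∀ i, inner ℝ (EuclideanSpace.basisFun (Fin N) ℝ i)
      (EuclideanSpace.basisFun (Fin N) ℝ i) = (1 : ℝ) := fun i => by simp
  simp only [real_inner_comm x, real_inner_self_eq_norm_sq] at h5
  simp only [h6, ← Finset.mul_sum, h5]
  simp only [mul_one, Finset.sum_const, Finset.card_univ, Fintype.card_fin, nsmul_eq_mul]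
  field_simp
  ring

/-! ### Integration against a Laplacian -/

/-- Use each partial derivative of `φ` as a test function in the definition of the weak gradient,
keep the matching component, and sum. -/
theorem HasWeakGradient.integral_inner_gradient {u : Euc N → ℝ} {G : Euc N → Euc N}
    (hu : HasWeakGradient u G) {φ : Euc N → ℝ} (hφ : ContDiff ℝ ∞ φ) (hφc : HasCompactSupport φ) :
    ∫ x, inner ℝ (G x) (gradient φ x) = - ∫ x, u x * (Δ φ) x := by
  set b := EuclideanSpace.basisFun (Fin N) ℝ with hb
  set η : Fin N → Euc N → ℝ := fun i x => fderiv ℝ φ x (b i) with hη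
  have hηd : ∀ i, ContDiff ℝ ∞ (η i) := fun i =>
    (hφ.fderiv_right (m := ∞) (by simp)).clm_apply contDiff_const
  have hηc : ∀ i, HasCompactSupport (η i) := fun i => hφc.fderiv_apply (𝕜 := ℝ) (b i)
  have i₁ : ∀ i, Integrable fun x => η i x * inner ℝ (G x) (b i) := fun i => by
    have := (hu.2.1.integrable_smul_left_of_hasCompactSupport (hηd i).continuous (hηc i)).inner_const
      (𝕜 := ℝ) (b i)
    simpa only [inner_smul_left, conj_trivial] using this
  have i₂ : ∀ i, Integrable fun x => u x * fderiv ℝ (η i) x (b i) := fun i => by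
    have := (hu.1.integrable_smul_right_of_hasCompactSupport
      (continuous_gradient (hηd i) (by simp)) (HasCompactSupport.gradient (hηc i))).inner_const (𝕜 := ℝ) (b i)
    simpa only [inner_smul_left, conj_trivial, inner_gradient_left] using this
  have key : ∀ i, ∫ x, u x * fderiv ℝ (η i) x (b i) = - ∫ x, η i x * inner ℝ (G x) (b i) := by
    intro i
    have h := congrArg (fun z => inner ℝ (b i) z) (hu.2.2 (η i) (hηd i) (hηc i))
    simp only [inner_neg_right] at h
    rw [← integral_inner (hu.1.integrable_smul_right_of_hasCompactSupport
      (continuous_gradient (hηd i) (by simp)) (HasCompactSupport.gradient (hηc i))),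
      ← integral_inner (hu.2.1.integrable_smul_left_of_hasCompactSupport
        (hηd i).continuous (hηc i))] at h
    simp only [inner_smul_right, inner_gradient_right, conj_trivial] at h
    simp only [real_inner_comm (b i)]
    exact h
  have e₁ : ∀ x, inner ℝ (G x) (gradient φ x) = ∑ i, η i x * inner ℝ (G x) (b i) := fun x => by
    rw [← b.sum_inner_mul_inner]
    refine Finset.sum_congr rfl fun i _ => ?_
    rw [inner_gradient_right, conj_trivial, mul_comm]
  have e₂ : ∀ x, u x * (Δ φ) x = ∑ i, u x * fderiv ℝ (η i) x (b i) := fun x => by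
    rw [InnerProductSpace.laplacian_eq_iteratedFDeriv_orthonormalBasis _ b, ← Finset.mul_sum]
    congr 1
    refine Finset.sum_congr rfl fun i _ => ?_
    rw [iteratedFDeriv_two_apply]
    have hd : DifferentiableAt ℝ (fderiv ℝ φ) x :=
      (hφ.fderiv_right (m := ∞) (by simp)).differentiable (by simp) x
    simp only [hη]
    rw [fderiv_clm_apply hd (differentiableAt_const _)]
    simp
  simp only [e₁, e₂]
  rw [integral_finsetSum _ fun i _ => i₁ i, integral_finsetSum _ fun i _ => i₂ i,
    ← Finset.sum_neg_distrib]
  exact Finset.sum_congr rfl fun i _ => by rw [key i, neg_neg]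

/-! ### Test functions supported away from the origin -/

/-- Smooth functions with compact support in `(0, ∞)`. -/
structure IsProfile (ψ : ℝ → ℝ) : Prop where
  contDiff : ContDiff ℝ ∞ ψ
  hasCompactSupport : HasCompactSupport ψ
  tsupport_subset : tsupport ψ ⊆ Set.Ioi 0

protected theorem IsProfile.deriv {ψ : ℝ → ℝ} (hψ : IsProfile ψ) : IsProfile (deriv ψ) :=
  ⟨(hψ.contDiff.of_le (by simp)).deriv', hψ.hasCompactSupport.deriv,
    tsupport_deriv_subset.trans hψ.tsupport_subset⟩

/-- The support of `k` lies in that of `ψ`, away from `0`; thus the coefficients, controlled only on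
`(0, ∞)`, yield globally continuous integrands. -/
theorem IsProfile.continuous_of_continuousOn {ψ k : ℝ → ℝ} (hψ : IsProfile ψ)
    (hk : ContinuousOn k (Set.Ioi 0)) (h0 : ∀ r, ψ r = 0 → k r = 0) : Continuous k := by
  refine hk.continuous_of_tsupport_subset isOpen_Ioi ((closure_mono ?_).trans hψ.tsupport_subset)
  exact fun r hr h => hr (h0 r h)

theorem hasCompactSupport_comp_norm {k : ℝ → ℝ} (hk : HasCompactSupport k) :
    HasCompactSupport fun x : Euc N => k ‖x‖ := by
  obtain ⟨R, hR⟩ := hk.isCompact.isBounded.subset_closedBall 0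
  refine HasCompactSupport.intro (isCompact_closedBall (0 : Euc N) R) fun x hx => ?_
  refine image_eq_zero_of_notMem_tsupport fun h => hx ?_
  simpa using hR h

theorem IsProfile.integrable_comp_norm {ψ k : ℝ → ℝ} (hψ : IsProfile ψ)
    (hk : ContinuousOn k (Set.Ioi 0)) (h0 : ∀ r, ψ r = 0 → k r = 0) :
    Integrable fun x : Euc N => k ‖x‖ := by
  refine ((hψ.continuous_of_continuousOn hk h0).comp continuous_norm).integrable_of_hasCompactSupport
    (hasCompactSupport_comp_norm ?_)
  exact hψ.hasCompactSupport.mono fun r hr h => hr (h0 r h)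

theorem IsProfile.isRadialTest {ψ : ℝ → ℝ} (hψ : IsProfile ψ) :
    IsRadialTest fun x : Euc N => ψ ‖x‖ := by
  refine ⟨contDiff_iff_contDiffAt.2 fun x => ?_, hasCompactSupport_comp_norm hψ.hasCompactSupport,
    fun x y h => by simp only [h]⟩
  by_cases hx : x ∈ tsupport fun x : Euc N => ψ ‖x‖
  · have h1 : 0 < ‖x‖ := hψ.tsupport_subset (tsupport_comp_subset_preimage ψ continuous_norm hx)
    exact hψ.contDiff.contDiffAt.comp x (contDiffAt_norm ℝ (norm_pos_iff.1 h1))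
  -- This case includes the origin, where the norm is not smooth but the function vanishes nearby.
  · exact contDiffAt_const.congr_of_eventuallyEq (notMem_tsupport_iff_eventuallyEq.1 hx)

theorem IsRadialTest.weakGradient_ae_eq {φ : Euc N → ℝ} (hφ : IsRadialTest φ) :
    weakGradient φ =ᵐ[volume] gradient φ :=
  (hasWeakGradient_of_contDiff (hφ.1.of_le (by simp))).weakGradient_ae_eq

theorem IsRadialTest.memD {φ : Euc N → ℝ} (hφ : IsRadialTest φ) : MemD φ := by
  refine ⟨hφ.1.continuous.memLp_of_hasCompactSupport hφ.2.1,
    ⟨_, hasWeakGradient_of_contDiff (hφ.1.of_le (by simp))⟩,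
    (memLp_congr_ae hφ.weakGradient_ae_eq).2 hφ.memLp_gradient, fun _ => φ, fun _ => hφ, ?_, ?_⟩
  · simp
  · have h : gradient φ - weakGradient φ =ᵐ[volume] 0 := by
      filter_upwards [hφ.weakGradient_ae_eq] with x hx
      simp [hx]
    simp [eLpNorm_congr_ae h]

theorem IsProfile.memE {V : ℝ → ℝ} (hV : ContinuousOn V (Set.Ioi 0)) {ψ : ℝ → ℝ}
    (hψ : IsProfile ψ) : MemE V fun x : Euc N => ψ ‖x‖ :=
  ⟨hψ.isRadialTest.memD, hψ.integrable_comp_norm (k := fun r => V r * cv (ψ r) ^ 2)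
    (hV.mul ((continuous_cv.comp hψ.contDiff.continuous).pow 2).continuousOn)
    fun r hr => by simp [hr, cv_zero]⟩

theorem IsProfile.laplacian {ψ : ℝ → ℝ} (hψ : IsProfile ψ) {x : Euc N} (hx : x ≠ 0) :
    (Δ (fun y : Euc N => ψ ‖y‖)) x =
      deriv (deriv ψ) ‖x‖ + (N - 1) / ‖x‖ * deriv ψ ‖x‖ :=
  laplacian_comp_norm hx
    (fun r _ => (hψ.contDiff.differentiable (by simp) r).hasDerivAt)
    (hψ.deriv.contDiff.differentiable (by simp) _).hasDerivAt

/-! ### The functional is finite on `E` -/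

/-- The supremum controls the normalised function `u / ‖u‖`; homogeneity of degree `q` transfers the
bound back to `u`. -/
theorem integrableOn_of_supOn {V K w : ℝ → ℝ} {q : ℝ} {A : Set (Euc N)} (hN : 0 < N)
    (hV : ContinuousOn V (Set.Ioi 0)) (hV0 : ∀ r > 0, 0 ≤ V r)
    (hK : ContinuousOn K (Set.Ioi 0)) (hK0 : ∀ r > 0, 0 < K r) (hq : 0 ≤ q)
    (hA : supOn V K q A < ⊤) {u : Euc N → ℝ} (hu : MemE V u) (hu0 : normE V u ≠ 0)
    (hw : ContinuousOn w (Set.Ioi 0)) (huw : u =ᵐ[volume] fun x => w ‖x‖) :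
    IntegrableOn (fun x => K ‖x‖ * |w ‖x‖| ^ q) A := by
  have hc : 0 < normE V u := lt_of_le_of_ne (normE_nonneg hV0 hN u) hu0.symm
  set c := normE V u with hcdef
  have hm : AEStronglyMeasurable (fun x : Euc N => K ‖x‖ * |w ‖x‖| ^ q) volume :=
    aestronglyMeasurable_comp_norm hN
      (h := fun r => K r * |w r| ^ q) (hK.mul (hw.abs.rpow_const fun _ _ => Or.inr hq))
  have h1 : ∫⁻ x in A, ENNReal.ofReal (K ‖x‖ * |(c⁻¹ • u) x| ^ q) < ⊤ := by
    refine lt_of_le_of_lt ?_ hA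
    refine le_iSup_of_le (c⁻¹ • u) (le_iSup_of_le (hu.const_smul hV hV0 hN (inv_pos.2 hc).le)
      (le_iSup_of_le ?_ le_rfl))
    rw [normE_const_smul V hu.1 (inv_pos.2 hc), inv_mul_cancel₀ hc.ne']
  have h2 : IntegrableOn (fun x => K ‖x‖ * |(c⁻¹ • u) x| ^ q) A := by
    have e : (fun x => c⁻¹ ^ q * (K ‖x‖ * |w ‖x‖| ^ q)) =ᵐ[volume]
        fun x => K ‖x‖ * |(c⁻¹ • u) x| ^ q := by
      filter_upwards [huw] with x hx
      rw [Pi.smul_apply, hx, smul_eq_mul, abs_mul, abs_of_pos (inv_pos.2 hc),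
        Real.mul_rpow (inv_pos.2 hc).le (abs_nonneg _)]
      ring
    refine ⟨((hm.const_mul _).congr e).restrict, ?_⟩
    rw [hasFiniteIntegral_iff_ofReal]
    · exact h1
    · refine ae_restrict_of_ae ?_
      filter_upwards [ae_ne_zero hN] with x hx
      exact mul_nonneg (hK0 _ (norm_pos_iff.2 hx)).le (by positivity)
  refine (h2.const_mul (c ^ q)).congr (ae_restrict_of_ae ?_)
  filter_upwards [huw] with x hx
  rw [Pi.smul_apply, hx, smul_eq_mul, abs_mul, abs_of_pos (inv_pos.2 hc),
    Real.mul_rpow (inv_pos.2 hc).le (abs_nonneg _), mul_left_comm, ← mul_assoc (c ^ q),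
    ← Real.mul_rpow hc.le (inv_pos.2 hc).le, mul_inv_cancel₀ hc.ne', Real.one_rpow, one_mul]

/-- Since `|f(t)| ≤ |t|`, the integrand is at most `C K |u|^q` with `q = q₁` near the origin and `q
= q₂` near infinity, where the suprema apply. In between, continuity on a compact set suffices. -/
theorem integrable_primitive {V K g w : ℝ → ℝ} {q₁ q₂ : ℝ} (hN : 0 < N)
    (hVK : HypH V K) (hg : Continuous g) (hq₁ : 1 < q₁) (hq₂ : 1 < q₂) (hgq : HypGrowth g q₁ q₂)
    (hS : CondS' N V K q₁ q₂) {u : Euc N → ℝ} (hu : MemE V u)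
    (hw : ContinuousOn w (Set.Ioi 0)) (huw : u =ᵐ[volume] fun x => w ‖x‖)
    (hz : dirichletNorm u = 0 → ∀ r > 0, w r = 0) :
    Integrable fun x : Euc N => K ‖x‖ * primitive g (cv (w ‖x‖)) := by
  obtain ⟨hV, hV0, hK, hK0, -⟩ := hVK
  obtain ⟨R₁, hR₁, R₂, hR₂, hS₁, hS₂⟩ := hS
  obtain ⟨C, hC, hgC⟩ := hgq
  by_cases hu0 : normE V u = 0
  · have h0 : dirichletNorm u = 0 := by
      have h1 : 0 ≤ dirichletNorm u := Real.sqrt_nonneg _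
      have h2 := orliczNorm_nonneg hV0 hN u
      rw [normE] at hu0
      linarith
    refine (integrable_zero (Euc N) ℝ volume).congr ?_
    filter_upwards [ae_ne_zero hN] with x hx
    simp [hz h0 _ (norm_pos_iff.2 hx), cv_zero, primitive_zero]
  have hcont : ContinuousOn (fun r => K r * primitive g (cv (w r))) (Set.Ioi 0) :=
    hK.mul (((continuous_primitive hg).comp continuous_cv).comp_continuousOn hw)
  have hm := aestronglyMeasurable_comp_norm hN hcont
  have hbd : ∀ q : ℝ, 1 < q → (∀ t, |g t| ≤ C * |t| ^ (q - 1)) → ∀ A : Set (Euc N),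
      supOn V K q A < ⊤ →
      IntegrableOn (fun x : Euc N => K ‖x‖ * primitive g (cv (w ‖x‖))) A := by
    intro q hq hgq A hA
    refine ((integrableOn_of_supOn hN hV hV0 hK hK0 (by linarith) hA hu hu0 hw huw).const_mul
      C).mono' hm.restrict (ae_restrict_of_ae ?_)
    filter_upwards [ae_ne_zero hN] with x hx
    have hKx := hK0 _ (norm_pos_iff.2 hx)
    rw [Real.norm_eq_abs, abs_mul, abs_of_pos hKx, mul_left_comm]
    refine mul_le_mul_of_nonneg_left ?_ hKx.le
    refine (abs_primitive_le hC.le hq hgq _).trans ?_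
    exact mul_le_mul_of_nonneg_left (Real.rpow_le_rpow (abs_nonneg _) (abs_cv_le _)
      (by linarith)) hC.le
  have i₁ := hbd q₁ hq₁ (fun t => (hgC t).trans (by gcongr; exact min_le_left _ _)) _ hS₁
  have i₂ := hbd q₂ hq₂ (fun t => (hgC t).trans (by gcongr; exact min_le_right _ _)) _ hS₂
  -- The radii are not ordered: this annulus may be empty, and the three sets cover the space in
  -- either case.
  have i₃ : IntegrableOn (fun x : Euc N => K ‖x‖ * primitive g (cv (w ‖x‖)))
      (Metric.closedBall 0 R₂ \ Metric.ball 0 R₁) := by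
    refine ContinuousOn.integrableOn_compact
      ((isCompact_closedBall (0 : Euc N) R₂).diff Metric.isOpen_ball) ?_
    refine (continuousOn_comp_norm hcont).mono fun x hx h => hx.2 ?_
    rw [Set.mem_singleton_iff.1 h]
    exact Metric.mem_ball_self hR₁
  rw [← integrableOn_univ]
  refine ((i₁.union i₂).union i₃).mono_set fun x _ => ?_
  by_cases h1 : x ∈ Metric.ball (0 : Euc N) R₁
  · exact Or.inl (Or.inl h1)
  by_cases h2 : x ∈ Metric.ball (0 : Euc N) R₂
  · exact Or.inr ⟨Metric.ball_subset_closedBall h2, h1⟩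
  · exact Or.inl (Or.inr h2)

/-! ### The derivative of the functional along a test function -/

/-- Dominated convergence. On the support of `ψ`, `w` is bounded, so for `|t| < 1` the argument
stays in a compact interval on which `Φ'` is bounded; off the support the integrand does not depend
on `t`. -/
theorem hasDerivAt_integral_comp (hN : 0 < N) {a Φ Φ' w ψ : ℝ → ℝ}
    (ha : ContinuousOn a (Set.Ioi 0)) (hΦ : ∀ s, HasDerivAt Φ (Φ' s) s) (hΦ' : Continuous Φ')
    (hw : ContinuousOn w (Set.Ioi 0)) (hψ : IsProfile ψ)
    (hint : Integrable fun x : Euc N => a ‖x‖ * Φ (w ‖x‖)) :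
    HasDerivAt (fun t : ℝ => ∫ x : Euc N, a ‖x‖ * Φ (w ‖x‖ + t * ψ ‖x‖))
      (∫ x : Euc N, a ‖x‖ * Φ' (w ‖x‖) * ψ ‖x‖) 0 := by
  have hΦc : Continuous Φ := continuous_iff_continuousAt.2 fun s => (hΦ s).continuousAt
  have hψc := hψ.contDiff.continuous
  obtain ⟨M, hM⟩ := hψ.hasCompactSupport.isCompact.exists_bound_of_continuousOn
    (hw.mono hψ.tsupport_subset)
  obtain ⟨M', hM'⟩ := hψ.hasCompactSupport.isCompact.exists_bound_of_continuousOn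
    hψc.continuousOn
  obtain ⟨B, hB⟩ := (isCompact_Icc (a := -(M + M')) (b := M + M')).exists_bound_of_continuousOn
    hΦ'.continuousOn
  have hmeas : ∀ t : ℝ, AEStronglyMeasurable
      (fun x : Euc N => a ‖x‖ * Φ (w ‖x‖ + t * ψ ‖x‖)) volume := fun t =>
    aestronglyMeasurable_comp_norm hN (h := fun r => a r * Φ (w r + t * ψ r))
      (ha.mul (hΦc.comp_continuousOn (hw.add (continuousOn_const.mul hψc.continuousOn))))
  have h := (hasDerivAt_integral_of_dominated_loc_of_deriv_le (μ := (volume : Measure (Euc N)))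
    (F := fun t x => a ‖x‖ * Φ (w ‖x‖ + t * ψ ‖x‖))
    (F' := fun t x => a ‖x‖ * Φ' (w ‖x‖ + t * ψ ‖x‖) * ψ ‖x‖) (x₀ := 0)
    (bound := fun x => B * |a ‖x‖| * |ψ ‖x‖|) (Metric.ball_mem_nhds (0 : ℝ) one_pos)
    (Eventually.of_forall hmeas) (by simpa using hint) ?_ ?_ ?_ ?_).2
  · simpa using h
  · exact aestronglyMeasurable_comp_norm hN (h := fun r => a r * Φ' (w r + 0 * ψ r) * ψ r)
      ((ha.mul (hΦ'.comp_continuousOn (hw.add (continuousOn_const.mul hψc.continuousOn)))).mul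
        hψc.continuousOn)
  · refine ae_of_all _ fun x t ht => ?_
    by_cases hx : ‖x‖ ∈ tsupport ψ
    · have h1 := hM _ hx
      have h2 := hM' _ hx
      rw [Real.norm_eq_abs] at h1 h2
      have ht' : |t| ≤ 1 := by
        rw [Metric.mem_ball, dist_zero_right] at ht
        exact ht.le
      have h3 : |w ‖x‖ + t * ψ ‖x‖| ≤ M + M' := by
        refine (abs_add_le _ _).trans (add_le_add h1 ?_)
        rw [abs_mul]
        nlinarith [abs_nonneg (ψ ‖x‖), abs_nonneg t]
      have h4 := hB _ (Set.mem_Icc.2 (abs_le.1 h3))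
      rw [norm_mul, norm_mul, Real.norm_eq_abs, Real.norm_eq_abs (ψ _), mul_comm |a ‖x‖|]
      gcongr
    · simp [image_eq_zero_of_notMem_tsupport hx]
  · exact hψ.integrable_comp_norm (k := fun r => B * |a r| * |ψ r|)
      ((continuousOn_const.mul ha.abs).mul hψc.abs.continuousOn) fun r hr => by simp [hr]
  · refine ae_of_all _ fun x t _ => ?_
    have h1 : HasDerivAt (fun t : ℝ => w ‖x‖ + t * ψ ‖x‖) (ψ ‖x‖) t := by
      simpa using ((hasDerivAt_id t).mul_const (ψ ‖x‖)).const_add (w ‖x‖)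
    have h2 := ((hΦ _).comp t h1).const_mul (a ‖x‖)
    rw [← mul_assoc] at h2
    exact h2

/-- The weak gradient is linear up to null sets, so the Dirichlet energy along the line is a
quadratic polynomial in `t`, and its linear coefficient is the derivative. -/
theorem hasDerivAt_dirichlet {u φ : Euc N → ℝ} (hu : MemD u) (hφ : IsRadialTest φ) :
    HasDerivAt (fun t : ℝ => 1 / 2 * ∫ x, ‖weakGradient (u + t • φ) x‖ ^ 2)
      (∫ x, inner ℝ (weakGradient u x) (gradient φ x)) 0 := by
  have hg := hu.2.2.1
  have hp := hφ.memLp_gradient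
  have i₁ : Integrable fun x => ‖weakGradient u x‖ ^ 2 := hg.norm.integrable_sq
  have i₂ : Integrable fun x => ‖gradient φ x‖ ^ 2 := hp.norm.integrable_sq
  have i₃ : Integrable fun x => (inner ℝ (weakGradient u x) (gradient φ x) : ℝ) := by
    refine (hg.norm.integrable_mul hp.norm).mono' (hg.1.inner hp.1) (ae_of_all _ fun x => ?_)
    exact norm_inner_le_norm _ _
  have e : ∀ t : ℝ, ∫ x, ‖weakGradient (u + t • φ) x‖ ^ 2 =
      (∫ x, ‖weakGradient u x‖ ^ 2) + t * (2 * ∫ x, inner ℝ (weakGradient u x) (gradient φ x))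
        + t ^ 2 * ∫ x, ‖gradient φ x‖ ^ 2 := fun t => by
    have h1 := (hu.hasWeakGradient.add ((hasWeakGradient_of_contDiff
      (hφ.1.of_le (by simp))).const_smul t)).weakGradient_ae_eq
    have h2 : (fun x => ‖weakGradient (u + t • φ) x‖ ^ 2) =ᵐ[volume] fun x =>
        ‖weakGradient u x‖ ^ 2 + t * (2 * inner ℝ (weakGradient u x) (gradient φ x))
        + t ^ 2 * ‖gradient φ x‖ ^ 2 := by
      filter_upwards [h1] with x hx
      rw [hx, Pi.add_apply, Pi.smul_apply, norm_add_sq_real, inner_smul_right, norm_smul, mul_pow,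
        Real.norm_eq_abs, sq_abs]
      ring
    rw [integral_congr_ae h2, integral_add, integral_add, integral_const_mul, integral_const_mul,
      integral_const_mul]
    · exact i₁
    · exact (i₃.const_mul 2).const_mul t
    · exact i₁.add ((i₃.const_mul 2).const_mul t)
    · exact i₂.const_mul _
  simp only [e]
  have hd := ((((hasDerivAt_id (0 : ℝ)).mul_const
    (2 * ∫ x, inner ℝ (weakGradient u x) (gradient φ x))).const_add
    (∫ x, ‖weakGradient u x‖ ^ 2)).add (((hasDerivAt_id (0 : ℝ)).pow 2).mul_const
      (∫ x, ‖gradient φ x‖ ^ 2))).const_mul (1 / 2)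
  refine HasDerivAt.congr_deriv hd ?_
  simp

/-- The reaction term of the equation, along a radial function `w`. -/
def reaction (V K g w : ℝ → ℝ) (r : ℝ) : ℝ :=
  V r * (cv (w r) * deriv cv (w r)) - K r * (g (cv (w r)) * deriv cv (w r))

theorem continuousOn_reaction {V K g w : ℝ → ℝ} (hV : ContinuousOn V (Set.Ioi 0))
    (hK : ContinuousOn K (Set.Ioi 0)) (hg : Continuous g) (hw : ContinuousOn w (Set.Ioi 0)) :
    ContinuousOn (reaction V K g w) (Set.Ioi 0) :=
  (hV.mul ((continuous_cv.mul continuous_deriv_cv).comp_continuousOn hw)).sub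
    (hK.mul (((hg.comp continuous_cv).mul continuous_deriv_cv).comp_continuousOn hw))

theorem hasDerivAt_functional (hN : 0 < N) {V K g w ψ : ℝ → ℝ}
    (hV : ContinuousOn V (Set.Ioi 0)) (hK : ContinuousOn K (Set.Ioi 0)) (hg : Continuous g)
    {u : Euc N → ℝ} (hu : MemE V u) (hw : ContinuousOn w (Set.Ioi 0))
    (huw : u =ᵐ[volume] fun x => w ‖x‖)
    (hint : Integrable fun x : Euc N => K ‖x‖ * primitive g (cv (w ‖x‖))) (hψ : IsProfile ψ) :
    HasDerivAt (fun t : ℝ => functional V K g (u + t • fun x => ψ ‖x‖))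
      ((∫ x, inner ℝ (weakGradient u x) (gradient (fun x : Euc N => ψ ‖x‖) x)) +
        ∫ x : Euc N, reaction V K g w ‖x‖ * ψ ‖x‖) 0 := by
  have hcv : ∀ s, HasDerivAt cv (deriv cv s) s := fun s =>
    (hasDerivAt_cv s).differentiableAt.hasDerivAt
  have h1 := hasDerivAt_dirichlet hu.1 (hψ.isRadialTest (N := N))
  have h2 := hasDerivAt_integral_comp hN (Φ := fun s => cv s ^ 2)
    (Φ' := fun s => 2 * (cv s * deriv cv s)) hV
    (fun s => by
      have h := (hcv s).fun_pow 2
      simpa [mul_assoc] using h)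
    (continuous_const.mul (continuous_cv.mul continuous_deriv_cv)) hw hψ
    (hu.2.congr (by filter_upwards [huw] with x hx; rw [hx]))
  have h3 := hasDerivAt_integral_comp hN (Φ := fun s => primitive g (cv s))
    (Φ' := fun s => g (cv s) * deriv cv s) hK
    (fun s => (hasDerivAt_primitive hg (cv s)).comp s (hcv s))
    ((hg.comp continuous_cv).mul continuous_deriv_cv) hw hψ hint
  have h4 := (h1.add (h2.const_mul (1 / 2))).sub h3
  have e : ∀ t : ℝ, ∀ᵐ x : Euc N, (u + t • fun x : Euc N => ψ ‖x‖) x = w ‖x‖ + t * ψ ‖x‖ :=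
    fun t => by filter_upwards [huw] with x hx; simp [hx]
  have i₁ : Integrable fun x : Euc N => V ‖x‖ * (cv (w ‖x‖) * deriv cv (w ‖x‖)) * ψ ‖x‖ :=
    hψ.integrable_comp_norm (k := fun r => V r * (cv (w r) * deriv cv (w r)) * ψ r)
      ((hV.mul ((continuous_cv.mul continuous_deriv_cv).comp_continuousOn hw)).mul
        hψ.contDiff.continuous.continuousOn) fun r hr => by simp [hr]
  have i₂ : Integrable fun x : Euc N => K ‖x‖ * (g (cv (w ‖x‖)) * deriv cv (w ‖x‖)) * ψ ‖x‖ :=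
    hψ.integrable_comp_norm (k := fun r => K r * (g (cv (w r)) * deriv cv (w r)) * ψ r)
      ((hK.mul (((hg.comp continuous_cv).mul continuous_deriv_cv).comp_continuousOn hw)).mul
        hψ.contDiff.continuous.continuousOn) fun r hr => by simp [hr]
  have e2 : ∫ x : Euc N, reaction V K g w ‖x‖ * ψ ‖x‖ =
      1 / 2 * (∫ x : Euc N, V ‖x‖ * (2 * (cv (w ‖x‖) * deriv cv (w ‖x‖))) * ψ ‖x‖) -
        ∫ x : Euc N, K ‖x‖ * (g (cv (w ‖x‖)) * deriv cv (w ‖x‖)) * ψ ‖x‖ := by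
    rw [← integral_const_mul, ← integral_sub (i₁.congr (ae_of_all _ fun x => by ring)) i₂]
    congr 1
    funext x
    rw [reaction]
    ring
  rw [e2, ← add_sub_assoc]
  refine h4.congr_of_eventuallyEq (Eventually.of_forall fun t => ?_)
  simp only [functional, Pi.add_apply, Pi.sub_apply]
  congr 1
  · congr 2
    refine integral_congr_ae ?_
    filter_upwards [e t] with x hx
    rw [← hx]; rfl
  · refine integral_congr_ae ?_
    filter_upwards [e t] with x hx
    rw [← hx]; rfl

/-- For small `t > 0` criticality bounds the difference quotient by `ε ‖φ‖`. Of the norm, only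
nonnegativity and positive homogeneity are used. -/
theorem IsCriticalPoint.eq_zero_of_hasDerivAt {V K g : ℝ → ℝ} {u : Euc N → ℝ}
    (hu : IsCriticalPoint V K g u) {φ : Euc N → ℝ} (hφ : MemE V φ)
    (hφn : ∀ c : ℝ, 0 ≤ c → MemE V (c • φ)) (hn : 0 ≤ normE V φ) {D : ℝ}
    (hD : HasDerivAt (fun t : ℝ => functional V K g (u + t • φ)) D 0) : D = 0 := by
  have h1 := hD.tendsto_slope_zero_right.abs
  have h2 : ∀ ε > 0, |D| ≤ ε * normE V φ := by
    intro ε hε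
    obtain ⟨δ, hδ, h⟩ := hu.2 ε hε
    refine le_of_tendsto h1 ?_
    have h3 : ∀ᶠ t : ℝ in 𝓝[>] 0, t * normE V φ < δ := by
      have : Tendsto (fun t : ℝ => t * normE V φ) (𝓝[>] 0) (𝓝 (0 * normE V φ)) :=
        ((continuous_id.mul continuous_const).tendsto 0).mono_left nhdsWithin_le_nhds
      rw [zero_mul] at this
      exact this.eventually_lt_const hδ
    filter_upwards [h3, self_mem_nhdsWithin] with t ht ht0
    have ht0 : 0 < t := ht0
    have e := normE_const_smul V hφ.1 ht0
    have h4 := h (t • φ) (hφn t ht0.le) (by rwa [e])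
    rw [e] at h4
    rw [zero_add, zero_smul, add_zero, smul_eq_mul, abs_mul, abs_inv, abs_of_pos ht0,
      inv_mul_le_iff₀ ht0]
    linarith
  by_contra hne
  -- The added `1` keeps the denominator positive when the norm vanishes; the bound then reads `|D|
  -- ≤ |D| / 2` at worst.
  have h3 := h2 (|D| / (2 * (normE V φ + 1))) (by positivity)
  have h4 : 0 < |D| := abs_pos.2 hne
  rw [div_mul_eq_mul_div, le_div_iff₀ (by positivity)] at h3
  nlinarith

/-- The weak form of the equation, in the radial variable. -/
theorem IsCriticalPoint.radial_weak_equation (hN : 3 ≤ N) {V K g w : ℝ → ℝ}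
    (hVK : HypH V K) (hg : Continuous g) {u : Euc N → ℝ}
    (hu : IsCriticalPoint V K g u) (hw : ContinuousOn w (Set.Ioi 0))
    (huw : u =ᵐ[volume] fun x => w ‖x‖)
    (hint : Integrable fun x : Euc N => K ‖x‖ * primitive g (cv (w ‖x‖)))
    {ψ : ℝ → ℝ} (hψ : IsProfile ψ) :
    ∫ r, w r * (r ^ (N - 1) * deriv (deriv ψ) r + (N - 1) * r ^ (N - 2) * deriv ψ r) =
      ∫ r, r ^ (N - 1) * reaction V K g w r * ψ r := by
  have hN0 : 0 < N := by omega
  obtain ⟨hV, hV0, hK, hK0, -⟩ := hVK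
  have h1 := hu.eq_zero_of_hasDerivAt (hψ.memE hV)
    (fun c hc => (hψ.memE hV).const_smul hV hV0 hN0 hc) (normE_nonneg hV0 hN0 _)
    (hasDerivAt_functional hN0 hV hK hg hu.1 hw huw hint hψ)
  rw [hu.1.1.hasWeakGradient.integral_inner_gradient hψ.isRadialTest.1 hψ.isRadialTest.2.1] at h1
  have h2 : ∫ x, u x * (Δ fun x : Euc N => ψ ‖x‖) x =
      ∫ x : Euc N, w ‖x‖ * (deriv (deriv ψ) ‖x‖ + (N - 1) / ‖x‖ * deriv ψ ‖x‖) := by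
    refine integral_congr_ae ?_
    filter_upwards [huw, ae_ne_zero hN0] with x hx hx0
    rw [hx, hψ.laplacian hx0]
  rw [h2, integral_comp_norm hN0 (fun r => reaction V K g w r * ψ r),
    integral_comp_norm hN0 (fun r => w r * (deriv (deriv ψ) r + (N - 1) / r * deriv ψ r)),
    ← mul_neg, ← mul_add, mul_eq_zero, or_iff_right (sphereArea_pos hN0).ne',
    neg_add_eq_zero] at h1
  -- Profiles and their derivatives vanish for `r ≤ 0`, so the polar integrals over `(0, ∞)` may be
  -- written over `ℝ`.
  have hzero : ∀ {η : ℝ → ℝ}, IsProfile η → ∀ r, r ∉ Set.Ioi (0 : ℝ) → η r = 0 :=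
    fun hη r hr => image_eq_zero_of_notMem_tsupport fun h => hr (hη.tsupport_subset h)
  rw [← setIntegral_eq_integral_of_forall_compl_eq_zero (s := Set.Ioi 0)
      (f := fun r => r ^ (N - 1) * reaction V K g w r * ψ r)
      (fun r hr => by rw [hzero hψ r hr, mul_zero]),
    ← setIntegral_eq_integral_of_forall_compl_eq_zero (s := Set.Ioi 0)
      (fun r hr => by rw [hzero hψ.deriv r hr, hzero hψ.deriv.deriv r hr]; ring)]
  simp only [mul_assoc]
  rw [← h1]
  refine setIntegral_congr_fun measurableSet_Ioi fun r hr => ?_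
  have hr0 : r ≠ 0 := (Set.mem_Ioi.1 hr).ne'
  have e : r ^ (N - 1) = r ^ (N - 2) * r := by rw [← pow_succ]; congr 1; omega
  simp only [e]
  field_simp

/-! ### Calculus with profiles -/

theorem IsProfile.exists_Icc {ψ : ℝ → ℝ} (hψ : IsProfile ψ) :
    ∃ a b, 0 < a ∧ ∀ r, r ∉ Set.Icc a b → ψ r = 0 := by
  -- Inserting the point `1` keeps the set nonempty, so the zero profile needs no separate case.
  have hc : IsCompact (insert 1 (tsupport ψ)) := hψ.hasCompactSupport.isCompact.insert 1
  obtain ⟨a, ha, ha'⟩ := hc.exists_isLeast ⟨1, Set.mem_insert _ _⟩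
  obtain ⟨b, hb, hb'⟩ := hc.exists_isGreatest ⟨1, Set.mem_insert _ _⟩
  refine ⟨a, b, ?_, fun r hr => image_eq_zero_of_notMem_tsupport fun h => hr
    ⟨ha' (Set.mem_insert_of_mem _ h), hb' (Set.mem_insert_of_mem _ h)⟩⟩
  rcases ha with rfl | h
  · exact one_pos
  · exact hψ.tsupport_subset h

theorem IsProfile.of_Icc {ψ : ℝ → ℝ} (hψ : ContDiff ℝ ∞ ψ) {a b : ℝ} (ha : 0 < a)
    (h : ∀ r, r ∉ Set.Icc a b → ψ r = 0) : IsProfile ψ := by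
  have hs : tsupport ψ ⊆ Set.Icc a b :=
    closure_minimal (fun r hr => by_contra fun h' => hr (h r h')) isClosed_Icc
  exact ⟨hψ, isCompact_Icc.of_isClosed_subset (isClosed_tsupport ψ) hs,
    hs.trans fun r hr => ha.trans_le hr.1⟩

theorem IsProfile.eq_zero_of_nonpos {ψ : ℝ → ℝ} (hψ : IsProfile ψ) {r : ℝ} (hr : r ≤ 0) :
    ψ r = 0 :=
  image_eq_zero_of_notMem_tsupport fun h => hr.not_gt (hψ.tsupport_subset h)

theorem IsProfile.mul_left {k ψ : ℝ → ℝ} (hψ : IsProfile ψ)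
    (hk : ∀ r > 0, ContDiffAt ℝ ∞ k r) : IsProfile fun r => k r * ψ r := by
  obtain ⟨a, b, ha, h⟩ := hψ.exists_Icc
  refine IsProfile.of_Icc (contDiff_iff_contDiffAt.2 fun r => ?_) ha fun r hr => by
    rw [h r hr, mul_zero]
  by_cases hr : r ∈ tsupport ψ
  · exact (hk r (hψ.tsupport_subset hr)).mul hψ.contDiff.contDiffAt
  · refine (contDiffAt_const (c := (0 : ℝ))).congr_of_eventuallyEq ?_
    filter_upwards [notMem_tsupport_iff_eventuallyEq.1 hr] with s hs
    simp [hs]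

/-- A profile of zero mean is the derivative of a profile. -/
theorem IsProfile.exists_primitive {η : ℝ → ℝ} (hη : IsProfile η) (h0 : ∫ r, η r = 0) :
    ∃ Θ, IsProfile Θ ∧ deriv Θ = η := by
  obtain ⟨a, b, ha, h⟩ := hη.exists_Icc
  have hd : ∀ r, HasDerivAt (fun r => ∫ s in (0 : ℝ)..r, η s) (η r) r := fun r =>
    (hη.contDiff.continuous.integral_hasStrictDerivAt 0 r).hasDerivAt
  have hd' : deriv (fun r => ∫ s in (0 : ℝ)..r, η s) = η := funext fun r => (hd r).deriv
  refine ⟨fun r => ∫ s in (0 : ℝ)..r, η s, IsProfile.of_Icc (a := a) (b := b) ?_ ha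
    fun r hr => ?_, hd'⟩
  · rw [contDiff_infty_iff_deriv, hd']
    exact ⟨fun r => (hd r).differentiableAt, hη.contDiff⟩
  · rcases lt_or_ge r a with h1 | h1
    · have h2 : ∀ s ∈ Set.uIcc 0 r, η s = 0 := fun s hs =>
        h s fun hs' => by
          have := hs.2
          rcases le_total 0 r with h3 | h3
          · rw [sup_of_le_right h3] at this; linarith [hs'.1]
          · rw [sup_of_le_left h3] at this; linarith [hs'.1]
      rw [intervalIntegral.integral_congr h2, intervalIntegral.integral_zero]
    · have h2 : b < r := lt_of_not_ge fun h2 => hr ⟨h1, h2⟩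
      refine Eq.trans ?_ h0
      refine intervalIntegral.integral_eq_integral_of_support_subset fun s hs => ?_
      have h3 : s ∈ Set.Icc a b := by_contra fun h' => hs (h s h')
      exact ⟨ha.trans_le h3.1, h3.2.trans h2.le⟩

theorem IsProfile.integrable_mul {k ψ : ℝ → ℝ} (hψ : IsProfile ψ)
    (hk : ContinuousOn k (Set.Ioi 0)) : Integrable fun r => k r * ψ r :=
  (hψ.continuous_of_continuousOn (hk.mul hψ.contDiff.continuous.continuousOn)
    fun r hr => by rw [Pi.mul_apply, hr, mul_zero]).integrable_of_hasCompactSupport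
    hψ.hasCompactSupport.mul_left

theorem IsProfile.integral_mul_deriv {p p' ψ : ℝ → ℝ} (hψ : IsProfile ψ)
    (hp : ∀ r > 0, HasDerivAt p (p' r) r) (hp' : ContinuousOn p' (Set.Ioi 0)) :
    ∫ r, p r * deriv ψ r = - ∫ r, p' r * ψ r := by
  have hpc : ContinuousOn p (Set.Ioi 0) := fun r hr => (hp r hr).continuousAt.continuousWithinAt
  have e : ∀ r, deriv p r * ψ r = p' r * ψ r := fun r => by
    by_cases hr : 0 < r
    · rw [(hp r hr).deriv]
    · rw [hψ.eq_zero_of_nonpos (not_lt.1 hr), mul_zero, mul_zero]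
  have h := integral_mul_fderiv_eq_neg_fderiv_mul_of_integrable (μ := (volume : Measure ℝ))
    (f := p) (g := ψ) (v := 1)
  simp only [fderiv_apply_one_eq_deriv, e] at h
  exact h (hψ.integrable_mul hp') (hψ.deriv.integrable_mul hpc) (hψ.integrable_mul hpc)
    (fun r hr => (hp r (hψ.tsupport_subset hr)).differentiableAt)
    (fun r _ => hψ.contDiff.differentiable (by simp) r)

/-- The space of profiles. -/
def profiles : Submodule ℝ (ℝ → ℝ) where
  carrier := {ψ | IsProfile ψ}
  zero_mem' := IsProfile.of_Icc (a := 1) (b := 1) contDiff_const one_pos fun _ _ => rfl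
  add_mem' := fun {φ ψ} hφ hψ => ⟨hφ.1.add hψ.1, hφ.2.add hψ.2,
    (tsupport_add φ ψ).trans (Set.union_subset hφ.3 hψ.3)⟩
  smul_mem' := fun c ψ hψ => by
    obtain ⟨a, b, ha, h⟩ := IsProfile.exists_Icc hψ
    exact IsProfile.of_Icc (hψ.1.const_smul c) (b := b) ha fun r hr => by simp [h r hr]

/-- Integration of profiles against a function that is continuous on `(0, ∞)`. -/
def profileFunctional {k : ℝ → ℝ} (hk : ContinuousOn k (Set.Ioi 0)) : profiles →ₗ[ℝ] ℝ where
  toFun ψ := ∫ r, k r * (ψ : ℝ → ℝ) r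
  map_add' φ ψ := by
    simp only [Submodule.coe_add, Pi.add_apply, mul_add]
    exact integral_add (IsProfile.integrable_mul φ.2 hk) (IsProfile.integrable_mul ψ.2 hk)
  map_smul' c ψ := by
    simp only [Submodule.coe_smul, Pi.smul_apply, smul_eq_mul, RingHom.id_apply,
      mul_left_comm _ c]
    exact integral_const_mul _ _

theorem eq_zero_of_integral_profile {k : ℝ → ℝ} (hk : ContinuousOn k (Set.Ioi 0))
    (h : ∀ ψ, IsProfile ψ → ∫ r, k r * ψ r = 0) : ∀ r > 0, k r = 0 := by
  have h1 := isOpen_Ioi.ae_eq_zero_of_integral_contDiff_smul_eq_zero (μ := (volume : Measure ℝ))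
    (hk.locallyIntegrableOn measurableSet_Ioi) fun ψ h1 h2 h3 => by
      simpa only [smul_eq_mul, mul_comm] using h ψ ⟨h1, h2, h3⟩
  have h2 : k =ᵐ[volume.restrict (Set.Ioi 0)] fun _ => 0 :=
    (ae_restrict_iff' measurableSet_Ioi).2 h1
  exact fun r hr => Measure.eqOn_open_of_ae_eq h2 isOpen_Ioi hk continuousOn_const hr

/-- A function orthogonal to the profiles that are orthogonal to `1` and `ρ` is a combination
of `1` and `ρ`. -/
theorem exists_eq_add_mul_of_integral_profile {k ρ : ℝ → ℝ} (hk : ContinuousOn k (Set.Ioi 0))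
    (hρ : ContinuousOn ρ (Set.Ioi 0))
    (h : ∀ η, IsProfile η → ∫ r, η r = 0 → ∫ r, ρ r * η r = 0 → ∫ r, k r * η r = 0) :
    ∃ α β : ℝ, ∀ r > 0, k r = α + β * ρ r := by
  have h1 : ContinuousOn (fun _ : ℝ => (1 : ℝ)) (Set.Ioi 0) := continuousOn_const
  -- Linear algebra replaces the choice of correcting profiles: a functional vanishing on the common
  -- kernel of finitely many functionals lies in their span.
  have hmem := mem_span_of_iInf_ker_le_ker (L := ![profileFunctional h1, profileFunctional hρ])
    (K := profileFunctional hk) fun η hη => by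
      have h2 := (Submodule.mem_iInf _).1 hη 0
      have h3 := (Submodule.mem_iInf _).1 hη 1
      rw [LinearMap.mem_ker] at h2 h3 ⊢
      refine h η η.2 ?_ h3
      simpa [profileFunctional] using h2
  obtain ⟨c, hc⟩ := (Submodule.mem_span_range_iff_exists_fun ℝ).1 hmem
  refine ⟨c 0, c 1, fun r hr => ?_⟩
  have hzero := eq_zero_of_integral_profile (k := fun r => k r - (c 0 + c 1 * ρ r))
    (hk.sub (continuousOn_const.add (continuousOn_const.mul hρ))) (fun η hη => by
      have h2 := congrArg (fun F => F ⟨η, hη⟩) hc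
      simp only [Fin.sum_univ_two, Matrix.cons_val_zero, Matrix.cons_val_one, LinearMap.add_apply,
        LinearMap.smul_apply, profileFunctional, LinearMap.coe_mk, AddHom.coe_mk,
        smul_eq_mul] at h2
      have i₁ := hη.integrable_mul hk
      have i₂ := (hη.integrable_mul h1).const_mul (c 0)
      have i₃ := (hη.integrable_mul hρ).const_mul (c 1)
      have e : ∀ r, (k r - (c 0 + c 1 * ρ r)) * η r =
          k r * η r - (c 0 * (1 * η r) + c 1 * (ρ r * η r)) := fun r => by ring
      simp only [e]
      rw [integral_sub i₁ (i₂.fun_add i₃), integral_add i₂ i₃, integral_const_mul (c 0),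
        integral_const_mul (c 1), ← h2, sub_self]) r hr
  exact sub_eq_zero.1 hzero

/-! ### Regularity for the radial equation -/

theorem hasDerivAt_integral_of_continuousOn {k : ℝ → ℝ} (hk : ContinuousOn k (Set.Ioi 0)) {r : ℝ}
    (hr : 0 < r) : HasDerivAt (fun r => ∫ s in (1 : ℝ)..r, k s) (k r) r := by
  have hsub : Set.uIcc 1 r ⊆ Set.Ioi 0 := fun s hs => (lt_inf_iff.2 ⟨one_pos, hr⟩).trans_le hs.1
  exact intervalIntegral.integral_hasDerivAt_right (hk.mono hsub).intervalIntegrable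
    (hk.stronglyMeasurableAtFilter isOpen_Ioi r hr) (hk.continuousAt (Ioi_mem_nhds hr))

/-- Here `z` is a classical solution of `(r^n z')' = r^n H`, while `1` and `ρ` span the solutions of
the homogeneous equation. Each profile orthogonal to `1` and `ρ` has the form `(r^n ψ')'`, so `y -
z` annihilates it and equals `α + β ρ`. Hence `y' = r^(-n) (Φ + β)`, which is `C¹`. -/
theorem radial_regularity (n : ℕ) {y H : ℝ → ℝ} (hy : ContinuousOn y (Set.Ioi 0))
    (hH : ContinuousOn H (Set.Ioi 0))
    (h : ∀ ψ, IsProfile ψ →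
      ∫ r, y r * (r ^ n * deriv (deriv ψ) r + n * r ^ (n - 1) * deriv ψ r) =
        ∫ r, r ^ n * H r * ψ r) :
    ∃ y₁ y₂ : ℝ → ℝ, (∀ r > 0, HasDerivAt y (y₁ r) r) ∧ (∀ r > 0, HasDerivAt y₁ (y₂ r) r) ∧
      ContinuousOn y₂ (Set.Ioi 0) ∧ ∀ r > 0, y₂ r + n / r * y₁ r = H r := by
  have hpow : ContinuousOn (fun r : ℝ => r ^ n) (Set.Ioi 0) := (continuous_pow n).continuousOn
  have hinv : ContinuousOn (fun r : ℝ => (r ^ n)⁻¹) (Set.Ioi 0) :=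
    hpow.inv₀ fun r hr => pow_ne_zero n (Set.mem_Ioi.1 hr).ne'
  set Φ : ℝ → ℝ := fun r => ∫ s in (1 : ℝ)..r, s ^ n * H s with hΦ
  have hΦd : ∀ r > 0, HasDerivAt Φ (r ^ n * H r) r := fun r hr =>
    hasDerivAt_integral_of_continuousOn (hpow.mul hH) hr
  have hΦc : ContinuousOn Φ (Set.Ioi 0) := fun r hr => (hΦd r hr).continuousAt.continuousWithinAt
  set z : ℝ → ℝ := fun r => ∫ s in (1 : ℝ)..r, (s ^ n)⁻¹ * Φ s with hz
  have hzd : ∀ r > 0, HasDerivAt z ((r ^ n)⁻¹ * Φ r) r := fun r hr =>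
    hasDerivAt_integral_of_continuousOn (hinv.mul hΦc) hr
  have hzc : ContinuousOn z (Set.Ioi 0) := fun r hr => (hzd r hr).continuousAt.continuousWithinAt
  set ρ : ℝ → ℝ := fun r => ∫ s in (1 : ℝ)..r, (s ^ n)⁻¹ with hρ
  have hρd : ∀ r > 0, HasDerivAt ρ ((r ^ n)⁻¹) r := fun r hr =>
    hasDerivAt_integral_of_continuousOn hinv hr
  have hρc : ContinuousOn ρ (Set.Ioi 0) := fun r hr => (hρd r hr).continuousAt.continuousWithinAt
  obtain ⟨α, β, hαβ⟩ := exists_eq_add_mul_of_integral_profile (k := fun r => y r - z r)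
    (hy.sub hzc) hρc (fun η hη h0 hη1 => by
      -- Solve `(r^n ψ')' = η` within profiles. Orthogonality to `1` gives `Θ = r^n ψ'`;
      -- orthogonality to `ρ`, after integration by parts, says that `r^(-n) Θ` has zero mean, which
      -- gives `ψ`.
      obtain ⟨Θ, hΘ, hΘd⟩ := hη.exists_primitive h0
      have hθ : IsProfile fun r => (r ^ n)⁻¹ * Θ r := hΘ.mul_left fun r hr =>
        (contDiff_id.pow n).contDiffAt.inv (pow_ne_zero n hr.ne')
      have hθ0 : ∫ r, (r ^ n)⁻¹ * Θ r = 0 := by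
        have h2 := hΘ.integral_mul_deriv hρd hinv
        rw [hΘd, hη1] at h2
        linarith
      obtain ⟨ψ, hψ, hψd⟩ := hθ.exists_primitive hθ0
      have e₁ : ∀ r, r ^ n * deriv (deriv ψ) r + n * r ^ (n - 1) * deriv ψ r = η r := fun r => by
        by_cases hr : 0 < r
        · have h2 : (fun s => s ^ n * deriv ψ s) =ᶠ[𝓝 r] Θ := by
            filter_upwards [Ioi_mem_nhds hr] with s hs
            have hs : 0 < s := hs
            rw [hψd]
            field_simp
          have h3 := (((hasDerivAt_pow n r).mul
            (hψ.deriv.contDiff.differentiable (by simp) r).hasDerivAt).congr_of_eventuallyEq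
              h2.symm).deriv
          rw [hΘd] at h3
          rw [h3]; ring
        · rw [hψ.deriv.eq_zero_of_nonpos (not_lt.1 hr), hψ.deriv.deriv.eq_zero_of_nonpos
            (not_lt.1 hr), hη.eq_zero_of_nonpos (not_lt.1 hr)]
          ring
      have e₂ := h ψ hψ
      simp only [e₁] at e₂
      -- Two integrations by parts: `∫ z Θ' = -∫ r^(-n) Φ Θ = -∫ Φ ψ' = ∫ r^n H ψ`.
      have e₃ : ∫ r, z r * η r = ∫ r, r ^ n * H r * ψ r := by
        have h2 := hΘ.integral_mul_deriv hzd (hinv.mul hΦc)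
        have h3 := hψ.integral_mul_deriv hΦd (hpow.mul hH)
        rw [hΘd] at h2
        rw [hψd] at h3
        rw [h2, neg_eq_iff_eq_neg, ← h3]
        congr 1
        funext r
        ring
      simp only [sub_mul]
      rw [integral_sub (hη.integrable_mul hy) (hη.integrable_mul hzc), e₂, e₃, sub_self])
  refine ⟨fun r => (r ^ n)⁻¹ * (Φ r + β),
    fun r => -(n * r ^ (n - 1)) / (r ^ n) ^ 2 * (Φ r + β) + (r ^ n)⁻¹ * (r ^ n * H r), ?_, ?_, ?_, ?_⟩
  · intro r hr
    have h2 : y =ᶠ[𝓝 r] fun s => z s + (α + β * ρ s) := by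
      filter_upwards [Ioi_mem_nhds hr] with s hs
      rw [← hαβ s hs]; ring
    refine HasDerivAt.congr_of_eventuallyEq ?_ h2
    refine ((hzd r hr).add (((hρd r hr).const_mul β).const_add α)).congr_deriv ?_
    ring
  · intro r hr
    exact ((hasDerivAt_pow n r).inv (pow_ne_zero n hr.ne')).mul ((hΦd r hr).add_const β)
  · refine ((ContinuousOn.div (by fun_prop) (hpow.pow 2) fun r hr => ?_).mul
      (hΦc.add continuousOn_const)).add (hinv.mul (hpow.mul hH))
    exact pow_ne_zero _ (pow_ne_zero n (Set.mem_Ioi.1 hr).ne')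
  · intro r hr
    -- For `n = 0` the truncated exponent `n - 1` is harmless, since its coefficient `n` is zero.
    rcases n with - | n
    · simp
    · simp only [Nat.add_sub_cancel]
      field_simp
      ring

theorem contDiffOn_two_of_hasDerivAt {y y₁ y₂ : ℝ → ℝ} (h₁ : ∀ r > 0, HasDerivAt y (y₁ r) r)
    (h₂ : ∀ r > 0, HasDerivAt y₁ (y₂ r) r) (h₃ : ContinuousOn y₂ (Set.Ioi 0)) :
    ContDiffOn ℝ 2 y (Set.Ioi 0) := by
  have h1 : ContDiffOn ℝ 1 y₁ (Set.Ioi 0) := by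
    rw [show (1 : ℕ∞ω) = 0 + 1 from rfl, contDiffOn_succ_iff_deriv_of_isOpen isOpen_Ioi]
    refine ⟨fun r hr => (h₂ r hr).differentiableAt.differentiableWithinAt, by simp, ?_⟩
    rw [contDiffOn_zero]
    exact h₃.congr fun r hr => (h₂ r hr).deriv
  rw [show (2 : ℕ∞ω) = 1 + 1 from rfl, contDiffOn_succ_iff_deriv_of_isOpen isOpen_Ioi]
  exact ⟨fun r hr => (h₁ r hr).differentiableAt.differentiableWithinAt, by simp,
    h1.congr fun r hr => (h₁ r hr).deriv⟩

end

end QSchrodinger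

theorem theorem6p2 (N : ℕ) (hN : 3 ≤ N) (V K g : ℝ → ℝ) (q₁ q₂ : ℝ)
    (hVK : QSchrodinger.HypH V K) (hg : Continuous g)
    (hg₁ : QSchrodinger.HypG1 g) (hg₂ : QSchrodinger.HypG2 g)
    (hq₁ : 1 < q₁) (hq₂ : 1 < q₂) (hgq : QSchrodinger.HypGrowth g q₁ q₂)
    (hS : QSchrodinger.CondS' N V K q₁ q₂)
    (u : QSchrodinger.Euc N → ℝ) (hu : QSchrodinger.IsCriticalPoint V K g u) :
    ∃ v : QSchrodinger.Euc N → ℝ, v =ᵐ[volume] u ∧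
      ContDiffOn ℝ 2 v {0}ᶜ ∧
      ∀ x : QSchrodinger.Euc N, x ≠ 0 →
        -(Δ v x) + V ‖x‖ * QSchrodinger.cv (v x) * deriv QSchrodinger.cv (v x)
          = K ‖x‖ * g (QSchrodinger.cv (v x)) * deriv QSchrodinger.cv (v x) := by
  have hN0 : 0 < N := by omega
  obtain ⟨w, hw, huw, hz⟩ := hu.1.1.exists_continuousOn hN
  have hint := QSchrodinger.integrable_primitive hN0 hVK hg hq₁ hq₂ hgq hS hu.1 hw huw hz
  have hcast : ((N - 1 : ℕ) : ℝ) = N - 1 := by rw [Nat.cast_sub (by omega), Nat.cast_one]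
  obtain ⟨w₁, w₂, h₁, h₂, h₃, h₄⟩ := QSchrodinger.radial_regularity (N - 1) hw
    (QSchrodinger.continuousOn_reaction hVK.1 hVK.2.2.1 hg hw) fun ψ hψ => by
      rw [← hu.radial_weak_equation hN hVK hg hw huw hint hψ, hcast,
        show N - 1 - 1 = N - 2 by omega]
  refine ⟨fun x => w ‖x‖, huw.symm, ?_, fun x hx => ?_⟩
  · exact (QSchrodinger.contDiffOn_two_of_hasDerivAt h₁ h₂ h₃).comp
      (fun x hx => (contDiffAt_norm ℝ hx).contDiffWithinAt) fun x hx => norm_pos_iff.2 hx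
  · have h5 := h₄ _ (norm_pos_iff.2 hx)
    rw [hcast, QSchrodinger.reaction] at h5
    rw [QSchrodinger.laplacian_comp_norm hx h₁ (h₂ _ (norm_pos_iff.2 hx)), h5]
    ring
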